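/- Let $r,\ell,k$ be integers with $r\ge 3$, $1\le \ell\le r$ and $k\ge 1+r-\ell$. A complete $r$-uniform $(r,\ell)$-partite hypergraph has a finite vertex set $V$ partitioned into $r$ nonempty classes, and its edges are all $r$-element subsets of $V$ that meet each class in at most $\ell$ vertices. A $k$-coloring assigns to every edge a color from $\{1,\dots,k\}$ (not all colors need be used); it is spanning if every vertex is incident to an edge of each color that is used. A monochromatic component of color $i$ is a connected component of the hypergraph on $V$ formed by the edges of color $i$. Let $\mathrm{cov}(r,\ell,k)$ denote the maximum, over all complete $r$-uniform $(r,\ell)$-partite hypergraphs and all their spanning $k$-colorings, of the minimum number of monochromatic components whose union is $V$. Theorem. Unless $\ell=1$ and $k\ge 2r$, $$\mathrm{cov}(r,\ell,k)=1+\Bigl\lfloor\frac{k-r+\ell-1}{\ell}\Bigr\rfloor .$$ If $\ell=1$ and $k\ge 2r$, then the maximum $\mathrm{cov}(r,\ell,k)$ exists and $$1+\Bigl\lfloor\frac{k-r+\ell-1}{\ell}\Bigr\rfloor\le \mathrm{cov}(r,\ell,k)\le 2+\Bigl\lfloor\frac{k-r+\ell-1}{\ell}\Bigr\rfloor .$$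 -/

import Mathlib

universe u

namespace PartiteCover

/-- The edge set of the complete `r`-uniform `(r, ℓ)`-partite hypergraph on `V` whose partite classes
are the fibres of `part : V → Fin r`: all `r`-element sets meeting each class in at most `ℓ`
vertices. (That the classes are nonempty is the surjectivity of `part`, required below.) -/
def completeEdges {V : Type u} {r : ℕ} (part : V → Fin r) (ℓ : ℕ) : Set (Finset V) :=
  {e | e.card = r ∧ ∀ i : Fin r, (e.filter (fun v => part v = i)).card ≤ ℓ}

/-- A `k`-coloring of the edges of a hypergraph with edge set `E`, with colors in `Fin k`
(not every color has to be used). -/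
abbrev EdgeColoring {V : Type u} (E : Set (Finset V)) (k : ℕ) : Type u := E → Fin k

section

variable {V : Type u} {E : Set (Finset V)} {k : ℕ}

/-- A coloring is spanning if every vertex is incident to an edge of every color that is used. -/
def IsSpanning (col : EdgeColoring E k) : Prop :=
  ∀ i : Fin k, (∃ e : E, col e = i) → ∀ v : V, ∃ e : E, col e = i ∧ v ∈ (e : Finset V)

/-- `u` and `v` lie in a common edge of color `i`. -/
def MonoAdj (col : EdgeColoring E k) (i : Fin k) (u v : V) : Prop :=
  ∃ e : E, col e = i ∧ u ∈ (e : Finset V) ∧ v ∈ (e : Finset V)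

/-- The vertex set of the connected component of `v` in the subhypergraph (on the vertex set `V`)
of all edges of color `i`; it is `{v}` if `v` is in no edge of color `i`. -/
def monoComponent (col : EdgeColoring E k) (i : Fin k) (v : V) : Set V :=
  {w | Relation.ReflTransGen (MonoAdj col i) v w}

/-- `C` is the vertex set of a monochromatic component of some color. -/
def IsMonoComponent (col : EdgeColoring E k) (C : Set V) : Prop :=
  ∃ (i : Fin k) (v : V), C = monoComponent col i v

/-- The vertex set can be covered by `m` monochromatic components. -/
def CoverableBy (col : EdgeColoring E k) (m : ℕ) : Prop :=
  ∃ F : Finset (Set V), F.card = m ∧ (∀ C ∈ F, IsMonoComponent col C) ∧ ∀ v : V, ∃ C ∈ F, v ∈ C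

/-- The minimum number of monochromatic components needed to cover the vertex set. By
`exists_coverableBy` this is a genuine minimum on finite vertex sets as soon as there is a color. -/
noncomputable def coverNumber (col : EdgeColoring E k) : ℕ :=
  sInf {m | CoverableBy col m}

theorem exists_coverableBy [Finite V] (col : EdgeColoring E k) (i : Fin k) :
    ∃ m, CoverableBy col m := by
  classical
  have := Fintype.ofFinite V
  refine ⟨_, Finset.univ.image (monoComponent col i), rfl, ?_, ?_⟩
  · intro C hC
    obtain ⟨v, -, rfl⟩ := Finset.mem_image.1 hC
    exact ⟨i, v, rfl⟩
  · intro v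
    exact ⟨_, Finset.mem_image_of_mem _ (Finset.mem_univ v), Relation.ReflTransGen.refl⟩

end

/-- The set of all values of the cover number taken over all spanning `k`-colorings of complete
`r`-uniform `(r, ℓ)`-partite hypergraphs on finite vertex sets with nonempty partite classes. -/
def coverNumbers (r ℓ k : ℕ) : Set ℕ :=
  {m | ∃ (V : Type u) (_ : Finite V) (part : V → Fin r) (_ : Function.Surjective part)
      (col : EdgeColoring (completeEdges part ℓ) k), IsSpanning col ∧ coverNumber col = m}

/-- `cov(r, ℓ, k) = m`: the maximum of the cover number over all spanning `k`-colorings of complete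
`r`-uniform `(r, ℓ)`-partite hypergraphs exists and equals `m`. -/
def IsCov (r ℓ k m : ℕ) : Prop :=
  IsGreatest (coverNumbers.{u} r ℓ k) m

end PartiteCover

/-! Each color partitions `V` into blocks, its components: every edge lies in one block of some
color and, by spanning, every block contains an edge. A color is dead for a set S if S is in none of
its blocks. If one block does not cover `V`, an admissible S extends to an edge so that each new
vertex kills a further color, while an edge leaves a color alive. Hence at most k − 1 − (r − |S|)
colors are dead for S (`IsEdgeLabeling.card_dead_add_lt`). If no q blocks cover, some vertex avoids
any q prescribed blocks. The upper bounds play these facts against each other around a pair u, v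
separated in many colors.

For ℓ ≥ 2, take a maximal separated pair. A vertex avoiding q common blocks of u and v either gives
a better pair or separates too many colors; if fewer than q colors are common, u, v and a vertex
avoiding all common blocks kill every color. For ℓ = 2 the pair is taken across two classes, so that
every third vertex is allowed.

For ℓ = 1 put a = k − r + 1. Two vertices of different classes are separated in at most a colors,
and a transversal triple in at most a + 1. This always yields a cover by a + 1 blocks, and one by a
blocks if a ≤ r. The hard case is a = r: u, v are separated in r colors and share r − 1 blocks. The
far vertices, which lie in the class of u or v and avoid all shared blocks, must together escape
every block, yet they are too rigid for this (`not_uncoverable_self`).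

For the lower bound, vertices of one class may leave the main block in any m colors, all others in
at most one. An edge leaves main blocks in at most ℓm + (r − ℓ) < k colors, so it can be colored,
while any m components miss a vertex that leaves the main blocks among them. -/

namespace PartiteCover

/-! ### Labelings, dead colors and greedy extension to an edge -/

section Labelings

variable {V : Type u} {K L : Type*} {c : K → V → L}

/-- No `q` blocks (fibres of the labelings of the colors) cover the vertex set. -/
def Uncoverable (c : K → V → L) (q : ℕ) : Prop :=
  ∀ F : Finset (K × V), F.card ≤ q → ∃ x, ∀ p ∈ F, c p.1 x ≠ c p.1 p.2

theorem Uncoverable.mono {q q' : ℕ} (h : Uncoverable c q) (hq : q' ≤ q) : Uncoverable c q' :=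
  fun F hF => h F (hF.trans hq)

theorem Uncoverable.exists_ne {q : ℕ} (h : Uncoverable c q) (A B : Finset K) (t s : V)
    (hAB : A.card + B.card ≤ q) :
    ∃ x, (∀ i ∈ A, c i x ≠ c i t) ∧ ∀ i ∈ B, c i x ≠ c i s := by
  classical
  obtain ⟨x, hx⟩ := h (A.image (fun i => (i, t)) ∪ B.image (fun i => (i, s)))
    ((Finset.card_union_le _ _).trans
      ((Nat.add_le_add Finset.card_image_le Finset.card_image_le).trans hAB))
  refine ⟨x, fun i hi => hx (i, t) ?_, fun i hi => hx (i, s) ?_⟩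
  · exact Finset.mem_union_left _ (Finset.mem_image_of_mem _ hi)
  · exact Finset.mem_union_right _ (Finset.mem_image_of_mem _ hi)

theorem Uncoverable.exists_ne_of_mem {q : ℕ} (h : Uncoverable c q) (A : Finset K) (t : V)
    (hA : A.card ≤ q) : ∃ x, ∀ i ∈ A, c i x ≠ c i t := by
  obtain ⟨x, hx, -⟩ := h.exists_ne A ∅ t t (by simpa using hA)
  exact ⟨x, hx⟩

theorem Uncoverable.exists_ne_of_color {q : ℕ} (h : Uncoverable c q) (i : K) (T : Finset V)
    (hT : T.card ≤ q) : ∃ x, ∀ t ∈ T, c i x ≠ c i t := by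
  classical
  obtain ⟨x, hx⟩ := h (T.image (fun t => (i, t))) (Finset.card_image_le.trans hT)
  exact ⟨x, fun t ht => hx (i, t) (Finset.mem_image_of_mem _ ht)⟩

variable [Fintype K]

open Classical in
/-- The colors in which `u` and `v` have different labels. -/
noncomputable def sep (c : K → V → L) (u v : V) : Finset K :=
  Finset.univ.filter fun i => c i u ≠ c i v

open Classical in
/-- The colors in which some two vertices of `S` have different labels. -/
noncomputable def dead (c : K → V → L) (S : Finset V) : Finset K :=
  Finset.univ.filter fun i => ∃ u ∈ S, ∃ v ∈ S, c i u ≠ c i v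

@[simp] theorem mem_sep {u v : V} {i : K} : i ∈ sep c u v ↔ c i u ≠ c i v := by
  simp [sep]

theorem sep_comm (u v : V) : sep c u v = sep c v u := by
  ext i; simp [ne_comm]

theorem mem_dead {S : Finset V} {i : K} :
    i ∈ dead c S ↔ ∃ u ∈ S, ∃ v ∈ S, c i u ≠ c i v := by
  simp [dead]

theorem dead_mono {S T : Finset V} (h : S ⊆ T) : dead c S ⊆ dead c T := by
  intro i hi
  obtain ⟨u, hu, v, hv, huv⟩ := mem_dead.1 hi
  exact mem_dead.2 ⟨u, h hu, v, h hv, huv⟩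

theorem eq_of_notMem_dead {S : Finset V} {i : K} (hi : i ∉ dead c S) {u v : V} (hu : u ∈ S)
    (hv : v ∈ S) : c i u = c i v := by
  by_contra h
  exact hi (mem_dead.2 ⟨u, hu, v, hv, h⟩)

/-- A family of labelings behaving like the components of a spanning coloring of the complete
`(r, ℓ)`-partite hypergraph. -/
structure IsEdgeLabeling {r : ℕ} (part : V → Fin r) (ℓ : ℕ) (c : K → V → L) : Prop where
  edge : ∀ e ∈ completeEdges part ℓ, ∃ i, ∀ u ∈ e, ∀ v ∈ e, c i u = c i v
  block : ∀ i v, ∃ e ∈ completeEdges part ℓ, ∀ u ∈ e, c i u = c i v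

variable {r ℓ : ℕ} {part : V → Fin r}

/-- `S` meets every class in at most `ℓ` vertices. -/
def Admissible (part : V → Fin r) (ℓ : ℕ) (S : Finset V) : Prop :=
  ∀ i, (S.filter fun v => part v = i).card ≤ ℓ

theorem admissible_of_card_le {S : Finset V} (h : S.card ≤ ℓ) : Admissible part ℓ S :=
  fun _ => (Finset.card_filter_le _ _).trans h

theorem Admissible.insert [DecidableEq V] {S : Finset V} (hS : Admissible part ℓ S) {x : V}
    (hx : (S.filter fun v => part v = part x).card < ℓ) :
    Admissible part ℓ (insert x S) := by
  intro i
  rw [Finset.filter_insert]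
  split_ifs with h
  · subst h
    exact (Finset.card_insert_le _ _).trans hx
  · exact hS i

/-- An edge has a vertex in a class in which a smaller admissible set has room. -/
theorem exists_mem_edge_card_lt {S e : Finset V} (hSr : S.card < r)
    (he : e ∈ completeEdges part ℓ) :
    ∃ x ∈ e, (S.filter fun v => part v = part x).card < ℓ := by
  classical
  by_contra! hcon
  have h1 : e.card ≤ S.card := by
    rw [Finset.card_eq_sum_card_fiberwise (s := e) (t := e.image part)
      (fun v hv => Finset.mem_image_of_mem _ hv)]
    calc ∑ b ∈ e.image part, (e.filter fun v => part v = b).card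
        ≤ ∑ b ∈ e.image part, (S.filter fun v => part v = b).card := by
          refine Finset.sum_le_sum fun b hb => ?_
          obtain ⟨x, hx, rfl⟩ := Finset.mem_image.1 hb
          exact (he.2 _).trans (hcon x hx)
      _ ≤ ∑ b, (S.filter fun v => part v = b).card :=
          Finset.sum_le_sum_of_subset (Finset.subset_univ _)
      _ = S.card := (Finset.card_eq_sum_card_fiberwise (fun v _ => Finset.mem_univ _)).symm
  have := he.1
  omega

theorem exists_part_not_mem {S : Finset V} (hSr : S.card < r) (hs : Function.Surjective part) :
    ∃ x, ∀ v ∈ S, part v ≠ part x := by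
  classical
  obtain ⟨p, hp⟩ : ∃ p, p ∉ S.image part := by
    by_contra! hcon
    have : (Finset.univ : Finset (Fin r)).card ≤ S.card :=
      (Finset.card_le_card fun p _ => hcon p).trans Finset.card_image_le
    simp at this
    omega
  obtain ⟨x, rfl⟩ := hs p
  exact ⟨x, fun v hv hvx => hp (hvx ▸ Finset.mem_image_of_mem _ hv)⟩

/-- Extending `S` greedily to an edge kills one further color per vertex. -/
theorem IsEdgeLabeling.card_dead_add_lt (h : IsEdgeLabeling part ℓ c)
    (hs : Function.Surjective part) (hl : 1 ≤ ℓ) (hc : Uncoverable c 1) {S : Finset V}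
    (hne : S.Nonempty) (hS : Admissible part ℓ S) (hSr : S.card ≤ r) :
    (dead c S).card + r < Fintype.card K + S.card := by
  classical
  induction hn : r - S.card generalizing S with
  | zero =>
    have hcard : S.card = r := by omega
    obtain ⟨i, hi⟩ := h.edge S ⟨hcard, hS⟩
    have : (dead c S).card < Fintype.card K := by
      rw [← Finset.card_univ]
      refine Finset.card_lt_card ⟨Finset.subset_univ _, fun hsub => ?_⟩
      obtain ⟨u, hu, v, hv, huv⟩ := mem_dead.1 (hsub (Finset.mem_univ i))
      exact huv (hi u hu v hv)
    omega
  | succ n ih =>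
    have hlt : S.card < r := by omega
    -- With no color left alive, padding S by vertices of new classes gives an edge without a color,
    -- so this case is contradictory.
    by_cases hall : ∀ i, i ∈ dead c S
    · obtain ⟨x, hx⟩ := exists_part_not_mem hlt hs
      have hxS : x ∉ S := fun hxS => hx x hxS rfl
      have hcard : (insert x S).card = S.card + 1 := Finset.card_insert_of_notMem hxS
      have h0 : (S.filter fun v => part v = part x) = ∅ := by
        rw [Finset.filter_eq_empty_iff]; exact fun v hv => hx v hv
      have hT := ih (S := insert x S) ⟨x, Finset.mem_insert_self _ _⟩
        (hS.insert (by rw [h0]; exact hl)) (by omega) (by omega)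
      have : dead c (insert x S) = Finset.univ :=
        Finset.eq_univ_of_forall fun i => dead_mono (Finset.subset_insert _ _) (hall i)
      have h2 : dead c S = Finset.univ := Finset.eq_univ_of_forall hall
      rw [this, Finset.card_univ] at hT
      rw [h2, Finset.card_univ]
      omega
    · push Not at hall
      obtain ⟨i, hi⟩ := hall
      obtain ⟨v, hv⟩ := hne
      obtain ⟨x₀, hx₀⟩ := hc.exists_ne_of_mem {i} v (by simp)
      obtain ⟨e, he, hei⟩ := h.block i x₀
      obtain ⟨x, hxe, hx⟩ := exists_mem_edge_card_lt hlt he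
      have hxv : c i x ≠ c i v := by
        rw [hei x hxe]; exact hx₀ i (by simp)
      have hxS : x ∉ S := fun hxS => hxv (eq_of_notMem_dead hi hxS hv)
      have hcard : (insert x S).card = S.card + 1 := Finset.card_insert_of_notMem hxS
      have hT := ih (S := insert x S) ⟨x, Finset.mem_insert_self _ _⟩ (hS.insert hx)
        (by omega) (by omega)
      have : (dead c S).card < (dead c (insert x S)).card := by
        refine Finset.card_lt_card ⟨dead_mono (Finset.subset_insert _ _), fun hsub => hi ?_⟩
        exact hsub (mem_dead.2 ⟨x, Finset.mem_insert_self _ _, v,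
          Finset.mem_insert_of_mem hv, hxv⟩)
      omega

end Labelings

/-! ### Upper bound for ℓ ≥ 2 -/

section PartsOfSize

variable {V : Type u} {K L : Type*} {c : K → V → L} [Fintype K] {r ℓ : ℕ} {part : V → Fin r}

theorem sep_subset_dead {S : Finset V} {u v : V} (hu : u ∈ S) (hv : v ∈ S) :
    sep c u v ⊆ dead c S :=
  fun _ hi => mem_dead.2 ⟨u, hu, v, hv, mem_sep.1 hi⟩

/-- If there is no cover by `q` blocks, then `n ≤ ℓ` vertices never separate `n * q` colors. -/
theorem IsEdgeLabeling.card_dead_lt_mul (h : IsEdgeLabeling part ℓ c)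
    (hs : Function.Surjective part) (hl : 1 ≤ ℓ) (hlr : ℓ ≤ r) {q : ℕ} (hq : 1 ≤ q)
    (hk : Fintype.card K + ℓ ≤ r + ℓ * q) (hc : Uncoverable c q) {S : Finset V}
    (hne : S.Nonempty) (hS : S.card ≤ ℓ) :
    (dead c S).card < S.card * q := by
  classical
  induction hn : ℓ - S.card generalizing S with
  | zero =>
    have := h.card_dead_add_lt hs hl (hc.mono hq) hne (admissible_of_card_le hS) (hS.trans hlr)
    have hcard : S.card = ℓ := by omega
    rw [hcard] at this ⊢
    omega
  | succ n ih =>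
    by_contra! hcon
    obtain ⟨v, hv⟩ := hne
    have hext := h.card_dead_add_lt hs hl (hc.mono hq) ⟨v, hv⟩ (admissible_of_card_le hS)
      (hS.trans hlr)
    have hcompl : (dead c S)ᶜ.card = Fintype.card K - (dead c S).card := Finset.card_compl _
    -- The minimum covers the case of fewer than `q` living colors: then `x` kills all of them,
    -- which the greedy bound forbids.
    obtain ⟨A, hA, hAcard⟩ := Finset.exists_subset_card_eq
      (s := (dead c S)ᶜ) (n := min q (dead c S)ᶜ.card) (min_le_right _ _)
    obtain ⟨x, hx⟩ := hc.exists_ne_of_mem A v (hAcard.trans_le (min_le_left _ _))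
    have hdisj : Disjoint (dead c S) A :=
      Finset.disjoint_left.2 fun i hi hiA => Finset.mem_compl.1 (hA hiA) hi
    have hsub : dead c S ∪ A ⊆ dead c (insert x S) :=
      Finset.union_subset (dead_mono (Finset.subset_insert _ _)) fun i hi =>
        mem_dead.2 ⟨x, Finset.mem_insert_self _ _, v, Finset.mem_insert_of_mem hv, hx i hi⟩
    have hle := Finset.card_le_card hsub
    rw [Finset.card_union_of_disjoint hdisj, hAcard] at hle
    have hxS : x ∉ S := fun hxS => by
      obtain ⟨i, hi⟩ : A.Nonempty := by
        rw [← Finset.card_pos]; omega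
      exact hx i hi (eq_of_notMem_dead (Finset.mem_compl.1 (hA hi)) hxS hv)
    have hcard : (insert x S).card = S.card + 1 := Finset.card_insert_of_notMem hxS
    have hne' : (insert x S).Nonempty := ⟨x, Finset.mem_insert_self _ _⟩
    have hlt := ih hne' (by omega) (by omega)
    have hext' := h.card_dead_add_lt hs hl (hc.mono hq) hne'
      (admissible_of_card_le (ℓ := ℓ) (by omega)) (by omega)
    rw [hcard, add_one_mul] at hlt
    omega

/-- Two vertices separated in `s` colors and a third one avoiding them in the set `A` of common
blocks: the third one is far from one of them. -/
theorem two_mul_card_add_card_sep_le [DecidableEq K] {u v w : V} {A : Finset K}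
    (hA : Disjoint A (sep c u v)) (hw : ∀ i ∈ A, c i w ≠ c i v) :
    2 * A.card + (sep c u v).card ≤ (sep c w u).card + (sep c w v).card := by
  have h1 : A ∪ sep c u v ⊆ sep c w u ∪ sep c w v := by
    intro i hi
    simp only [Finset.mem_union, mem_sep] at hi ⊢
    by_contra! hcon
    rcases hi with hi | hi
    · exact hw i hi hcon.2
    · exact hi (hcon.1.symm.trans hcon.2)
  have h2 : A ⊆ sep c w u ∩ sep c w v := by
    intro i hi
    have : c i u = c i v := by
      by_contra hne
      exact Finset.disjoint_left.1 hA hi (mem_sep.2 hne)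
    simp only [Finset.mem_inter, mem_sep, this, and_self]
    exact hw i hi
  have h3 := Finset.card_le_card h1
  have h4 := Finset.card_le_card h2
  rw [Finset.card_union_of_disjoint hA] at h3
  have := Finset.card_union_add_card_inter (sep c w u) (sep c w v)
  omega

theorem exists_subset_sep_compl {u v : V} {n : ℕ} (h : (sep c u v).card + n ≤ Fintype.card K) :
    ∃ A : Finset K, A.card = n ∧ ∀ i ∈ A, c i u = c i v := by
  classical
  obtain ⟨A, hA, hAcard⟩ := Finset.exists_subset_card_eq (s := (sep c u v)ᶜ) (n := n)
    (by rw [Finset.card_compl]; omega)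
  exact ⟨A, hAcard, fun i hi => by simpa using hA hi⟩

theorem disjoint_sep [DecidableEq K] {u v : V} {A : Finset K} (hA : ∀ i ∈ A, c i u = c i v) :
    Disjoint A (sep c u v) :=
  Finset.disjoint_left.2 fun i hi hi' => mem_sep.1 hi' (hA i hi)

/-- For a maximal pair with s separating colors, a vertex avoiding q common blocks gives 2q + s ≤
2s, against s < 2q. With fewer than q common colors, three vertices kill everything, and ℓ ≥ 3 makes
them admissible. -/
theorem IsEdgeLabeling.not_uncoverable_of_three_le (h : IsEdgeLabeling part ℓ c)
    (hs : Function.Surjective part) (hl : 3 ≤ ℓ) (hlr : ℓ ≤ r) {q : ℕ} (hq : 1 ≤ q)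
    (hk : Fintype.card K + ℓ ≤ r + ℓ * q) [Finite V] : ¬ Uncoverable c q := by
  classical
  intro hc
  obtain ⟨x₀, -⟩ := hs ⟨0, by omega⟩
  have : Nonempty V := ⟨x₀⟩
  obtain ⟨⟨u, v⟩, hmax⟩ := Finite.exists_max (α := V × V)
    fun p => (sep c p.1 p.2).card
  by_cases hJ : (sep c u v).card + q ≤ Fintype.card K
  · obtain ⟨A, hAcard, hA⟩ := exists_subset_sep_compl hJ
    obtain ⟨w, hw⟩ := hc.exists_ne_of_mem A v hAcard.le
    have h1 := two_mul_card_add_card_sep_le (disjoint_sep hA) hw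
    have h2 := hmax (w, u)
    have h3 := hmax (w, v)
    simp only at h2 h3
    have huv : u ≠ v := by
      rintro rfl
      have : (sep c u u).card = 0 := by rw [Finset.card_eq_zero]; ext; simp
      omega
    have h4 := h.card_dead_lt_mul hs (by omega) hlr hq hk hc (S := {u, v}) (by simp)
      (by rw [Finset.card_pair huv]; omega)
    have h5 := Finset.card_le_card (sep_subset_dead (c := c) (S := {u, v}) (u := u) (v := v)
      (by simp) (by simp))
    rw [Finset.card_pair huv] at h4
    omega
  · obtain ⟨w, hw⟩ := hc.exists_ne_of_mem (sep c u v)ᶜ v (by rw [Finset.card_compl]; omega)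
    have hdead : dead c {u, v, w} = Finset.univ := by
      refine Finset.eq_univ_of_forall fun i => ?_
      by_cases hi : i ∈ sep c u v
      · exact sep_subset_dead (by simp) (by simp) hi
      · exact mem_dead.2 ⟨w, by simp, v, by simp, hw i (by simpa using hi)⟩
    have h3 : ({u, v, w} : Finset V).card ≤ 3 := Finset.card_le_three
    have h4 := h.card_dead_add_lt hs (by omega) (hc.mono hq) (S := {u, v, w}) (by simp)
      (admissible_of_card_le (by omega)) (by omega)
    rw [hdead, Finset.card_univ] at h4
    omega

theorem admissible_two_triple [DecidableEq V] {u v : V} (huv : part u ≠ part v) (w : V) :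
    Admissible part 2 {u, v, w} := by
  intro i
  have hsub : (({u, v, w} : Finset V).filter fun x => part x = i) ⊆
      if part u = i then {u, w} else {v, w} := by
    intro x hx
    simp only [Finset.mem_filter, Finset.mem_insert, Finset.mem_singleton] at hx
    split_ifs with hi <;> simp only [Finset.mem_insert, Finset.mem_singleton] <;> grind
  refine (Finset.card_le_card hsub).trans ?_
  split_ifs <;> exact Finset.card_le_two

/-- The triple bound gives s ≤ q for the maximal cross pair. A vertex w avoiding q common blocks is
then separated from one of u, v in exactly these q colors, hence from the other in 2q colors. -/
theorem IsEdgeLabeling.not_uncoverable_of_eq_two (h : IsEdgeLabeling part 2 c)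
    (hs : Function.Surjective part) (hr : 3 ≤ r) {q : ℕ} (hq : 1 ≤ q)
    (hk : Fintype.card K + 2 ≤ r + 2 * q) [Finite V] : ¬ Uncoverable c q := by
  classical
  intro hc
  have hcross : ∃ p : V × V, part p.1 ≠ part p.2 := by
    obtain ⟨x, hx⟩ := hs ⟨0, by omega⟩
    obtain ⟨y, hy⟩ := hs ⟨1, by omega⟩
    exact ⟨(x, y), by simp [hx, hy]⟩
  have := nonempty_subtype.2 hcross
  obtain ⟨⟨⟨u, v⟩, huv⟩, hmax⟩ := Finite.exists_max (α := {p : V × V // part p.1 ≠ part p.2})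
    fun p => (sep c p.1.1 p.1.2).card
  replace hmax : ∀ x y, part x ≠ part y → (sep c x y).card ≤ (sep c u v).card :=
    fun x y hxy => hmax ⟨(x, y), hxy⟩
  simp only at huv
  have hpair : ∀ x y, x ≠ y → (sep c x y).card < 2 * q := by
    intro x y hxy
    have h4 := h.card_dead_lt_mul hs (by omega) (by omega) hq hk hc (S := {x, y}) (by simp)
      (by rw [Finset.card_pair hxy])
    have h5 := Finset.card_le_card (sep_subset_dead (c := c) (S := {x, y}) (u := x) (v := y)
      (by simp) (by simp))
    rw [Finset.card_pair hxy] at h4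
    omega
  have htriple : ∀ w, (dead c {u, v, w}).card + r < Fintype.card K + 3 := by
    intro w
    have h3 : ({u, v, w} : Finset V).card ≤ 3 := Finset.card_le_three
    have h4 := h.card_dead_add_lt hs (by omega) (hc.mono hq) (S := {u, v, w}) (by simp)
      (admissible_two_triple huv w) (by omega)
    omega
  by_cases hJ : (sep c u v).card + q ≤ Fintype.card K
  · obtain ⟨A, hAcard, hA⟩ := exists_subset_sep_compl hJ
    obtain ⟨w, hw⟩ := hc.exists_ne_of_mem A v hAcard.le
    have hdisj := disjoint_sep hA
    have h1 := two_mul_card_add_card_sep_le hdisj hw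
    have hsub : sep c u v ∪ A ⊆ dead c {u, v, w} := by
      refine Finset.union_subset (sep_subset_dead (by simp) (by simp)) fun i hi => ?_
      exact mem_dead.2 ⟨w, by simp, v, by simp, hw i hi⟩
    have h2 := Finset.card_le_card hsub
    rw [Finset.card_union_of_disjoint hdisj.symm] at h2
    have h3 := htriple w
    have hlow : part w ≠ part u ∨ part w ≠ part v := by grind
    -- Here `y` is whichever of `u`, `v` is in another class than `w`, and `x` is the other one.
    have key : ∀ x y, (∀ i, i ∈ sep c u v → c i x ≠ c i y) → part w ≠ part y → x ≠ w →
        (∀ i ∈ A, c i w ≠ c i y) → (∀ i ∈ A, c i w ≠ c i x) → False := by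
      intro x y hxy hwy hxw hAy hAx
      have hAsub : A ⊆ sep c w y := fun i hi => mem_sep.2 (hAy i hi)
      have hle := hmax w y hwy
      have hAeq : A = sep c w y := Finset.eq_of_subset_of_card_le hAsub (by omega)
      have : sep c u v ∪ A ⊆ sep c x w := by
        refine Finset.union_subset (fun i hi => ?_) fun i hi => mem_sep.2 (hAx i hi).symm
        have hiA : i ∉ A := fun hiA => Finset.disjoint_left.1 hdisj hiA hi
        have hwyi : c i w = c i y := by
          by_contra hne; exact hiA (hAeq ▸ mem_sep.2 hne)
        rw [mem_sep, hwyi]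
        exact hxy i hi
      have := Finset.card_le_card this
      rw [Finset.card_union_of_disjoint hdisj.symm] at this
      have := hpair x w hxw
      have := Finset.card_le_card hAsub
      omega
    have hAu : ∀ i ∈ A, c i w ≠ c i u := fun i hi => by rw [hA i hi]; exact hw i hi
    obtain ⟨i₀, hi₀⟩ : A.Nonempty := by rw [← Finset.card_pos]; omega
    rcases hlow with hwu | hwv
    · exact key v u (fun i hi => (mem_sep.1 hi).symm) hwu
        (by rintro rfl; exact hw i₀ hi₀ rfl) hAu hw
    · exact key u v (fun i hi => mem_sep.1 hi) hwv
        (by rintro rfl; exact hAu i₀ hi₀ rfl) hw hAu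
  · obtain ⟨w, hw⟩ := hc.exists_ne_of_mem (sep c u v)ᶜ v (by rw [Finset.card_compl]; omega)
    have hdead : dead c {u, v, w} = Finset.univ := by
      refine Finset.eq_univ_of_forall fun i => ?_
      by_cases hi : i ∈ sep c u v
      · exact sep_subset_dead (by simp) (by simp) hi
      · exact mem_dead.2 ⟨w, by simp, v, by simp, hw i (by simpa using hi)⟩
    have h4 := htriple w
    rw [hdead, Finset.card_univ] at h4
    omega

end PartsOfSize

/-! ### Case ℓ = 1: separation bounds and the cover by k − r + 2 blocks -/

section Transversal

variable {V : Type u} {K L : Type*} {c : K → V → L} [Fintype K] {r : ℕ} {part : V → Fin r}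

/-- Consequences of the absence of a cover by `n` blocks, for labelings of `r`-partite
hypergraphs. -/
structure SeparationBounds [DecidableEq K] (part : V → Fin r) (c : K → V → L) (a n : ℕ) :
    Prop where
  three_le : 3 ≤ r
  pair : ∀ u v, part u ≠ part v → (sep c u v).card ≤ a
  triple : ∀ u v w, part u ≠ part v → part w ≠ part u → part w ≠ part v →
    (sep c u v ∪ sep c u w).card ≤ a + 1
  escape : ∀ (i : K) (p : Fin r) (T : Finset V), T.card ≤ n →
    ∃ w, part w = p ∧ ∀ t ∈ T, c i w ≠ c i t

theorem exists_mem_edge_part_eq {e : Finset V} (he : e ∈ completeEdges part 1) (p : Fin r) :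
    ∃ x ∈ e, part x = p := by
  classical
  have hinj : Set.InjOn part e := by
    intro x hx y hy hxy
    exact Finset.card_le_one.1 (he.2 (part x)) x (by simpa using hx) y
      (by simpa [hxy] using hy)
  have hcard : (e.image part).card = r := (Finset.card_image_of_injOn hinj).trans he.1
  have huniv : e.image part = Finset.univ := by
    rw [← Finset.card_eq_iff_eq_univ, hcard, Fintype.card_fin]
  simpa using huniv.ge (Finset.mem_univ p)

/-- The first two bounds are the greedy bound for two and three vertices. Escape holds in every
class because the block of an uncovered vertex contains an edge, which meets all classes. -/
theorem IsEdgeLabeling.separationBounds [DecidableEq K] (h : IsEdgeLabeling part 1 c)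
    (hs : Function.Surjective part) (hr : 3 ≤ r) {a n : ℕ} (hn : 1 ≤ n)
    (hk : Fintype.card K + 1 = r + a) (hc : Uncoverable c n) :
    SeparationBounds part c a n := by
  classical
  refine ⟨hr, fun u v huv => ?_, fun u v w huv hwu hwv => ?_, fun i p T hT => ?_⟩
  · have hne : u ≠ v := fun h => huv (h ▸ rfl)
    have hadm : Admissible part 1 {u, v} := by
      intro i
      rw [Finset.card_le_one]
      simp only [Finset.mem_filter, Finset.mem_insert, Finset.mem_singleton]
      grind
    have h1 := h.card_dead_add_lt hs le_rfl (hc.mono hn) (S := {u, v}) (by simp) hadm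
      (by rw [Finset.card_pair hne]; omega)
    rw [Finset.card_pair hne] at h1
    have h2 := Finset.card_le_card (sep_subset_dead (c := c) (S := {u, v}) (u := u) (v := v)
      (by simp) (by simp))
    omega
  · have h3 : ({u, v, w} : Finset V).card ≤ 3 := Finset.card_le_three
    have hadm : Admissible part 1 {u, v, w} := by
      intro i
      rw [Finset.card_le_one]
      simp only [Finset.mem_filter, Finset.mem_insert, Finset.mem_singleton]
      grind
    have h1 := h.card_dead_add_lt hs le_rfl (hc.mono hn) (S := {u, v, w}) (by simp) hadm
      (by omega)
    have h2 : (sep c u v ∪ sep c u w).card ≤ (dead c {u, v, w}).card :=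
      Finset.card_le_card (Finset.union_subset (sep_subset_dead (by simp) (by simp))
        (sep_subset_dead (by simp) (by simp)))
    omega
  · obtain ⟨x, hx⟩ := hc.exists_ne_of_color i T hT
    obtain ⟨e, he, hei⟩ := h.block i x
    obtain ⟨w, hwe, hw⟩ := exists_mem_edge_part_eq he p
    exact ⟨w, hw, fun t ht => by rw [hei w hwe]; exact hx t ht⟩

variable [DecidableEq K] {a n : ℕ}

theorem exists_ne_ne (hr : 3 ≤ r) (p p' : Fin r) : ∃ p'' : Fin r, p'' ≠ p ∧ p'' ≠ p' := by
  obtain ⟨p'', h⟩ : ∃ p'', p'' ∉ ({p, p'} : Finset (Fin r)) := by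
    by_contra! hcon
    have h1 : (Finset.univ : Finset (Fin r)).card ≤ _ := Finset.card_le_card fun p _ => hcon p
    have h2 : ({p, p'} : Finset (Fin r)).card ≤ 2 := Finset.card_le_two
    rw [Finset.card_univ, Fintype.card_fin] at h1
    omega
  exact ⟨p'', by simpa using h⟩

/-- A vertex outside the classes of `u` and `v` and outside given blocks of color `i`. -/
theorem SeparationBounds.exists_third (h : SeparationBounds part c a n) (u v : V) (i : K)
    (T : Finset V) (hT : T.card ≤ n) :
    ∃ w, part w ≠ part u ∧ part w ≠ part v ∧ ∀ t ∈ T, c i w ≠ c i t := by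
  obtain ⟨p, hpu, hpv⟩ := exists_ne_ne h.three_le (part u) (part v)
  obtain ⟨w, hw, hwT⟩ := h.escape i p T hT
  exact ⟨w, hw ▸ hpu, hw ▸ hpv, hwT⟩

theorem SeparationBounds.card_le (h : SeparationBounds part c a n) {u v : V}
    (huv : part u ≠ part v) {A : Finset K} (hA : ∀ i ∈ A, c i u ≠ c i v) : A.card ≤ a :=
  (Finset.card_le_card fun i hi => mem_sep.2 (hA i hi)).trans (h.pair u v huv)

theorem SeparationBounds.card_le_add_one (h : SeparationBounds part c a n) {u v w : V}
    (huv : part u ≠ part v) (hwu : part w ≠ part u) (hwv : part w ≠ part v) {A : Finset K}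
    (hA : ∀ i ∈ A, c i u ≠ c i v ∨ c i u ≠ c i w) : A.card ≤ a + 1 :=
  (Finset.card_le_card fun i hi => by simpa using hA i hi).trans (h.triple u v w huv hwu hwv)

theorem exists_part_ne (hs : Function.Surjective part) (hr : 3 ≤ r) :
    ∃ p : V × V, part p.1 ≠ part p.2 := by
  obtain ⟨x, hx⟩ := hs ⟨0, by omega⟩
  obtain ⟨y, hy⟩ := hs ⟨1, by omega⟩
  exact ⟨(x, y), by simp [hx, hy]⟩

theorem IsEdgeLabeling.not_uncoverable_add_one [Finite V] (h : IsEdgeLabeling part 1 c)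
    (hs : Function.Surjective part) (hr : 3 ≤ r)
    (hk : Fintype.card K + 1 = r + a) : ¬ Uncoverable c (a + 1) := by
  classical
  intro hc
  have hb := h.separationBounds hs hr (by omega) hk hc
  have := nonempty_subtype.2 (exists_part_ne hs hr)
  obtain ⟨⟨⟨u, v⟩, huv⟩, hmax⟩ := Finite.exists_max (α := {p : V × V // part p.1 ≠ part p.2})
    fun p => (sep c p.1.1 p.1.2).card
  replace hmax : ∀ x y, part x ≠ part y → (sep c x y).card ≤ (sep c u v).card :=
    fun x y hxy => hmax ⟨(x, y), hxy⟩
  replace huv : part u ≠ part v := huv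
  set s := (sep c u v).card with hsdef
  have hsa : s ≤ a := hb.pair u v huv
  -- Otherwise a vertex avoiding s + 1 common blocks forms a better cross pair with `u` or `v`.
  have hJ : Fintype.card K ≤ 2 * s := by
    by_contra! hlt
    obtain ⟨A, hAcard, hA⟩ := exists_subset_sep_compl (c := c) (u := u) (v := v) (n := s + 1)
      (by omega)
    obtain ⟨x, hx⟩ := hc.exists_ne_of_mem A v (by omega)
    rcases (show part x ≠ part u ∨ part x ≠ part v by grind) with hxu | hxv
    · have h1 := hmax x u hxu
      have h2 : A ⊆ sep c x u := fun i hi => mem_sep.2 (by rw [hA i hi]; exact hx i hi)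
      have := Finset.card_le_card h2
      omega
    · have h1 := hmax x v hxv
      have h2 : A ⊆ sep c x v := fun i hi => mem_sep.2 (hx i hi)
      have := Finset.card_le_card h2
      omega
  obtain ⟨i, hi⟩ : (sep c u v).Nonempty := by rw [← Finset.card_pos]; omega
  have hJcard : (sep c u v)ᶜ.card = Fintype.card K - s := Finset.card_compl _
  -- The size is chosen so that `I'` and the common colors together number a + 1; leaving out `i`
  -- gives the one extra color at the end.
  obtain ⟨I', hI', hI'card⟩ := Finset.exists_subset_card_eq (s := (sep c u v).erase i)
    (n := a + 1 - (Fintype.card K - s)) (by rw [Finset.card_erase_of_mem hi]; omega)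
  obtain ⟨z, hzu, hzv, hz⟩ := hb.exists_third u v i {u, v}
    (Finset.card_le_two.trans (by omega))
  obtain ⟨x, hxJ, hxI⟩ := hc.exists_ne (sep c u v)ᶜ I' u z (by omega)
  replace hxJ : ∀ j, c j u = c j v → c j x ≠ c j u := fun j hj => hxJ j (by simpa using hj)
  -- `x` lies in the class of `u` or of `v`
  have hx : part x = part u ∨ part x = part v := by
    by_contra! hcon
    have := hb.card_le_add_one huv hcon.1 hcon.2 (A := Finset.univ) fun j _ => by
      by_cases hj : c j u = c j v
      · exact Or.inr (hxJ j hj).symm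
      · exact Or.inl hj
    rw [Finset.card_univ] at this
    omega
  -- `v'` is the one of `u`, `v` outside the class of `x`. In each common color `z` differs from
  -- `v'` or from `x`, so the triple `z`, `x`, `v'` kills all common colors, `I'` and `i`: a + 2
  -- colors.
  have key : ∀ v', part x ≠ part v' → part z ≠ part v' → part x ≠ part z → c i z ≠ c i v' →
      (∀ j, c j u = c j v → c j v' = c j u) → False := by
    intro v' hxv' hzv' hxz hzi hv'
    set Jz := (sep c u v)ᶜ.filter fun j => c j z ≠ c j u
    set J' := (sep c u v)ᶜ.filter fun j => ¬ c j z ≠ c j u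
    have hJJ : Jz.card + J'.card = (sep c u v)ᶜ.card := Finset.card_filter_add_card_filter_not _
    have hJz : (sep c u v ∪ Jz).card ≤ a + 1 := hb.card_le_add_one huv hzu hzv fun j hj => by
      rcases Finset.mem_union.1 hj with hj | hj
      · exact Or.inl (mem_sep.1 hj)
      · exact Or.inr (Finset.mem_filter.1 hj).2.symm
    rw [Finset.card_union_of_disjoint (Finset.disjoint_right.2 fun j hj => by
      simpa using (Finset.mem_filter.1 hj).1)] at hJz
    have hsub : J' ∪ I' ⊆ sep c z x := by
      intro j hj
      rw [mem_sep]
      rcases Finset.mem_union.1 hj with hj | hj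
      · simp only [J', Finset.mem_filter, Finset.mem_compl, mem_sep, not_not] at hj
        rw [hj.2]
        exact (hxJ j hj.1).symm
      · exact (hxI j hj).symm
    have hdisj : Disjoint J' I' := Finset.disjoint_left.2 fun j hj hjI =>
      Finset.mem_compl.1 (Finset.mem_filter.1 hj).1 (Finset.mem_of_mem_erase (hI' hjI))
    have hle := (Finset.card_le_card hsub).trans (hmax z x hxz.symm)
    rw [Finset.card_union_of_disjoint hdisj] at hle
    have hbig : (insert i (Jz ∪ (J' ∪ I'))).card ≤ a + 1 :=
      hb.card_le_add_one hxz.symm hzv'.symm hxv'.symm fun j hj => by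
        rcases Finset.mem_insert.1 hj with rfl | hj
        · exact Or.inr hzi
        rcases Finset.mem_union.1 hj with hj | hj
        · simp only [Jz, Finset.mem_filter, Finset.mem_compl, mem_sep, not_not] at hj
          rw [hv' j hj.1]
          exact Or.inr hj.2
        · exact Or.inl (mem_sep.1 (hsub hj))
    rw [Finset.card_insert_of_notMem, Finset.card_union_of_disjoint,
      Finset.card_union_of_disjoint hdisj] at hbig
    · omega
    · refine Finset.disjoint_left.2 fun j hj hj' => ?_
      rcases Finset.mem_union.1 hj' with hj' | hj'
      · exact (Finset.mem_filter.1 hj').2 (Finset.mem_filter.1 hj).2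
      · exact Finset.mem_compl.1 (Finset.mem_filter.1 hj).1 (Finset.mem_of_mem_erase (hI' hj'))
    · intro hmem
      have hiu : i ∉ (sep c u v)ᶜ := by simpa using mem_sep.1 hi
      simp only [Finset.mem_union] at hmem
      rcases hmem with hmem | hmem | hmem
      · exact hiu (Finset.mem_filter.1 hmem).1
      · exact hiu (Finset.mem_filter.1 hmem).1
      · exact Finset.notMem_erase _ _ (hI' hmem)
  rcases hx with hx | hx
  · exact key v (hx ▸ huv) hzv (hx ▸ hzu.symm) (hz v (by simp)) fun j hj => hj.symm
  · exact key u (hx ▸ huv.symm) hzu (hx ▸ hzv.symm) (hz u (by simp)) fun j _ => rfl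

end Transversal

/-! ### Case ℓ = 1, k < 2r: pairs separated in exactly a colors -/

section Transversal

variable {V : Type u} {K L : Type*} {c : K → V → L} [Fintype K] {r : ℕ} {part : V → Fin r}
  [DecidableEq K] {a n : ℕ}

/-- Outside an extremal separated pair `x`, `v`, a vertex of a third class leaves the block of `v`
in at most one color. -/
theorem SeparationBounds.eq_of_ne (h : SeparationBounds part c a n) {x v w : V}
    (hxv : part x ≠ part v) (hd : a ≤ (sep c x v).card) (hwx : part w ≠ part x)
    (hwv : part w ≠ part v) {i i' : K} (hi : c i x = c i v) (hi' : c i' x = c i' v)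
    (hiw : c i w ≠ c i v) (hiw' : c i' w ≠ c i' v) : i = i' := by
  by_contra hne
  have h1 := h.card_le_add_one hxv hwx hwv (A := insert i (insert i' (sep c x v)))
    fun j hj => by
      simp only [Finset.mem_insert, mem_sep] at hj
      rcases hj with rfl | rfl | hj
      · exact Or.inr (by rw [hi]; exact hiw.symm)
      · exact Or.inr (by rw [hi']; exact hiw'.symm)
      · exact Or.inl hj
  rw [Finset.card_insert_of_notMem (by simp [hne, hi]),
    Finset.card_insert_of_notMem (by simp [hi'])] at h1
  omega

/-- As a ≤ r, a pair separated in fewer than a colors has a common ones; a vertex avoiding those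
blocks is separated in a colors from the member of the pair in another class. -/
theorem exists_extremal_pair (hs : Function.Surjective part) (hb : SeparationBounds part c a n)
    (hk : Fintype.card K + 1 = r + a) (har : a ≤ r) (hc : Uncoverable c a) :
    ∃ u v, part u ≠ part v ∧ (sep c u v).card = a := by
  obtain ⟨⟨u, v⟩, huv⟩ := exists_part_ne hs hb.three_le
  have hle := hb.pair u v huv
  by_cases hd : (sep c u v).card = a
  · exact ⟨u, v, huv, hd⟩
  obtain ⟨A, hAcard, hA⟩ := exists_subset_sep_compl (c := c) (u := u) (v := v) (n := a)
    (by omega)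
  obtain ⟨x, hx⟩ := hc.exists_ne_of_mem A v hAcard.le
  rcases (show part x ≠ part u ∨ part x ≠ part v by grind) with hxu | hxv
  · refine ⟨x, u, hxu, (hb.pair x u hxu).antisymm (hAcard ▸ Finset.card_le_card fun i hi => ?_)⟩
    rw [mem_sep, hA i hi]
    exact hx i hi
  · exact ⟨x, v, hxv, (hb.pair x v hxv).antisymm
      (hAcard ▸ Finset.card_le_card fun i hi => mem_sep.2 (hx i hi))⟩

/-- A vertex x avoiding a common blocks must lie in the class of u or v, say u, and x, v are
separated exactly in those colors. A third-class vertex w leaving v and x in one of them is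
separated from x in just the same colors. So w agrees with v wherever u and v differ, and leaves u
in a + 1 colors. -/
theorem not_uncoverable_of_lt (hb : SeparationBounds part c a n) (hk : Fintype.card K + 1 = r + a)
    (ha : 2 ≤ a) (han : a ≤ n) (har : a < r) {u v : V} (huv : part u ≠ part v)
    (hd : (sep c u v).card = a) : ¬ Uncoverable c a := by
  classical
  intro hc
  obtain ⟨A, hAcard, hA⟩ := exists_subset_sep_compl (c := c) (u := u) (v := v) (n := a)
    (by omega)
  obtain ⟨x, hx⟩ := hc.exists_ne_of_mem A v hAcard.le
  have hdisj := disjoint_sep hA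
  have hxuv : part x = part u ∨ part x = part v := by
    by_contra! hcon
    have h1 := hb.card_le_add_one huv hcon.1 hcon.2 (A := A ∪ sep c u v) fun i hi => by
      rcases Finset.mem_union.1 hi with hi | hi
      · exact Or.inr (by rw [hA i hi]; exact (hx i hi).symm)
      · exact Or.inl (mem_sep.1 hi)
    rw [Finset.card_union_of_disjoint hdisj] at h1
    omega
  have key : ∀ u v, part x = part u → part u ≠ part v → (sep c u v).card = a →
      Disjoint A (sep c u v) → (∀ i ∈ A, c i u = c i v) → (∀ i ∈ A, c i x ≠ c i v) → False := by
    intro u v hxu huv hd hdisj hA hx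
    have hxv : part x ≠ part v := hxu ▸ huv
    have hAx : A = sep c x v := Finset.eq_of_subset_of_card_le
      (fun i hi => mem_sep.2 (hx i hi)) (hAcard ▸ hb.pair x v hxv)
    obtain ⟨j, hj⟩ : A.Nonempty := by rw [← Finset.card_pos]; omega
    obtain ⟨w, hwu, hwv, hw⟩ := hb.exists_third u v j {v, x}
      (Finset.card_le_two.trans (by omega))
    have hwx : part w ≠ part x := hxu ▸ hwu
    have hwvj : c j w ≠ c j v := hw v (by simp)
    have hwA : ∀ i ∈ A, i ≠ j → c i w = c i v := fun i hi hij => by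
      by_contra hne
      exact hij (hb.eq_of_ne huv hd.ge hwu hwv (hA i hi) (hA j hj) hne hwvj)
    have hAw : A = sep c w x := by
      refine Finset.eq_of_subset_of_card_le (fun i hi => ?_) (hAcard ▸ hb.pair w x hwx)
      rw [mem_sep]
      by_cases hij : i = j
      · subst hij; exact hw x (by simp)
      · rw [hwA i hi hij]; exact (hx i hi).symm
    have hbig := hb.card_le hwu (A := insert j (sep c u v)) fun i hi => by
      rcases Finset.mem_insert.1 hi with rfl | hi
      · rw [hA i hj]; exact hwvj
      · have hiA : i ∉ A := fun hiA => Finset.disjoint_left.1 hdisj hiA hi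
        have h1 : c i w = c i x := by
          by_contra hne; exact hiA (hAw ▸ mem_sep.2 hne)
        have h2 : c i x = c i v := by
          by_contra hne; exact hiA (hAx ▸ mem_sep.2 hne)
        rw [h1, h2]
        exact (mem_sep.1 hi).symm
    rw [Finset.card_insert_of_notMem (Finset.disjoint_left.1 hdisj hj)] at hbig
    omega
  rcases hxuv with hxu | hxv
  · exact key u v hxu huv hd hdisj hA hx
  · refine key v u hxv huv.symm (sep_comm (c := c) u v ▸ hd) (sep_comm (c := c) u v ▸ hdisj)
      (fun i hi => (hA i hi).symm) fun i hi => ?_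
    rw [hA i hi]
    exact hx i hi

/-- A third-class vertex leaving the common block in color j already uses its only separation from
both u and v, so it would join their blocks in color i. -/
theorem not_separationBounds_one (hk : Fintype.card K = r) (hn : 1 ≤ n) {u v : V}
    (hd : (sep c u v).card = 1) : ¬ SeparationBounds part c 1 n := by
  intro hb
  have hr := hb.three_le
  obtain ⟨A, hAcard, hA⟩ := exists_subset_sep_compl (c := c) (u := u) (v := v) (n := 1)
    (by omega)
  obtain ⟨j, rfl⟩ := Finset.card_eq_one.1 hAcard
  obtain ⟨i, hi⟩ := Finset.card_eq_one.1 hd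
  have hi' : c i u ≠ c i v := mem_sep.1 (hi ▸ Finset.mem_singleton_self i)
  have hj := hA j (by simp)
  have hij : i ≠ j := fun h => hi' (h ▸ hj)
  obtain ⟨w, hwu, hwv, hw⟩ := hb.exists_third u v j {u} (by simpa using hn)
  have hwj := hw u (by simp)
  have key : ∀ y, part w ≠ part y → c j y = c j u → c i w = c i y := by
    intro y hwy hy
    by_contra hne
    have h1 := hb.card_le hwy (A := {i, j}) fun i' hi' => by
      simp only [Finset.mem_insert, Finset.mem_singleton] at hi'
      rcases hi' with rfl | rfl
      · exact hne
      · rw [hy]; exact hwj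
    rw [Finset.card_pair hij] at h1
    omega
  exact hi' ((key u hwu rfl).symm.trans (key v hwv hj.symm))

/-! ### Far vertices in the case k = 2r − 1 -/

/-- `x` is in the class of `u` but in none of the common blocks of `u` and `v`. -/
def Far (c : K → V → L) (part : V → Fin r) (u v x : V) : Prop :=
  part x = part u ∧ ∀ j, c j u = c j v → c j x ≠ c j u

theorem card_common (hk : Fintype.card K + 1 = r + r) {u v : V} (hd : (sep c u v).card = r) :
    (sep c u v)ᶜ.card + 1 = r := by
  rw [Finset.card_compl]
  omega

/-- A vertex outside the class of a far vertex `x` and outside its blocks in all common colors of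
`u` and `v` leaves the block of `x` in at most one other color. -/
theorem Far.eq_of_ne {u v x : V} (hx : Far c part u v x) (h : SeparationBounds part c r n)
    (hk : Fintype.card K + 1 = r + r) (hd : (sep c u v).card = r) {w : V}
    (hw : part w ≠ part u) (hwx : ∀ j, c j u = c j v → c j w ≠ c j x) {i i' : K}
    (hi : c i u ≠ c i v) (hi' : c i' u ≠ c i' v) (hiw : c i w ≠ c i x)
    (hiw' : c i' w ≠ c i' x) : i = i' := by
  by_contra hne
  have hJ := card_common hk hd
  have h1 := h.card_le (u := w) (v := x) (hx.1.symm ▸ hw)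
    (A := insert i (insert i' (sep c u v)ᶜ)) fun j hj => by
      simp only [Finset.mem_insert, Finset.mem_compl, mem_sep, not_not] at hj
      rcases hj with rfl | rfl | hj
      exacts [hiw, hiw', hwx j hj]
  rw [Finset.card_insert_of_notMem (by simp [hne, hi]),
    Finset.card_insert_of_notMem (by simp [hi'])] at h1
  omega

/-- A vertex of a third class leaves the block of a far vertex in at most two of the colors
separating `u` and `v`. -/
theorem Far.card_le_two {u v x : V} (hx : Far c part u v x) (h : SeparationBounds part c r n)
    (hk : Fintype.card K + 1 = r + r) (huv : part u ≠ part v) (hd : (sep c u v).card = r) {w : V}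
    (hwu : part w ≠ part u) (hwv : part w ≠ part v) {T : Finset K}
    (hT : ∀ i ∈ T, c i u ≠ c i v ∧ c i w ≠ c i x) : T.card ≤ 2 := by
  have hJ := card_common hk hd
  obtain ⟨j₀, hj₀⟩ : (sep c u v)ᶜ.Nonempty := by
    rw [← Finset.card_pos]; have := h.three_le; omega
  -- `j₁` is the only common color in which `w` may leave the block of `v`; `j₀` serves as default
  -- if there is none.
  obtain ⟨j₁, hj₁⟩ : ∃ j₁, ∀ j, c j u = c j v → j ≠ j₁ → c j w = c j v := by
    by_cases hall : ∀ j, c j u = c j v → c j w = c j v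
    · exact ⟨j₀, fun j hj _ => hall j hj⟩
    · push Not at hall
      obtain ⟨j₁, hj₁, hne⟩ := hall
      refine ⟨j₁, fun j hj hjj => ?_⟩
      by_contra hne'
      exact hjj (h.eq_of_ne huv hd.ge hwu hwv hj hj₁ hne' hne)
  have h1 := h.card_le (u := w) (v := x) (hx.1.symm ▸ hwu)
    (A := T ∪ (sep c u v)ᶜ.erase j₁) fun j hj => by
      simp only [Finset.mem_union, Finset.mem_erase, Finset.mem_compl, mem_sep, not_not] at hj
      rcases hj with hj | hj
      · exact (hT j hj).2
      · rw [hj₁ j hj.2 hj.1, ← hj.2]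
        exact (hx.2 j hj.2).symm
  rw [Finset.card_union_of_disjoint] at h1
  · have := Finset.pred_card_le_card_erase (s := (sep c u v)ᶜ) (a := j₁)
    omega
  · refine Finset.disjoint_left.2 fun j hj hj' => ?_
    simp only [Finset.mem_erase, Finset.mem_compl, mem_sep, not_not] at hj'
    exact (hT j hj).1 hj'.2

theorem Far.not_three_ne {u v x : V} (hx : Far c part u v x) (h : SeparationBounds part c r n)
    (hk : Fintype.card K + 1 = r + r) (huv : part u ≠ part v) (hd : (sep c u v).card = r) {w : V}
    (hwu : part w ≠ part u) (hwv : part w ≠ part v) {i₁ i₂ i₃ : K} (h₁₂ : i₁ ≠ i₂)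
    (h₁₃ : i₁ ≠ i₃) (h₂₃ : i₂ ≠ i₃) (h₁ : c i₁ u ≠ c i₁ v) (h₂ : c i₂ u ≠ c i₂ v)
    (h₃ : c i₃ u ≠ c i₃ v) (hw₁ : c i₁ w ≠ c i₁ x) (hw₂ : c i₂ w ≠ c i₂ x)
    (hw₃ : c i₃ w ≠ c i₃ x) : False := by
  have := hx.card_le_two h hk huv hd hwu hwv (T := {i₁, i₂, i₃}) fun j hj => by
    simp only [Finset.mem_insert, Finset.mem_singleton] at hj
    rcases hj with rfl | rfl | rfl
    exacts [⟨h₁, hw₁⟩, ⟨h₂, hw₂⟩, ⟨h₃, hw₃⟩]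
  rw [Finset.card_eq_three.2 ⟨_, _, _, h₁₂, h₁₃, h₂₃, rfl⟩] at this
  omega

/-- A far vertex leaves the block of `v` in at most one of the colors separating `u` and `v`. -/
theorem Far.unique_ne {u v x : V} (hx : Far c part u v x) (h : SeparationBounds part c r n)
    (hk : Fintype.card K + 1 = r + r) (huv : part u ≠ part v) (hd : (sep c u v).card = r)
    {i i' : K} (hi : c i u ≠ c i v) (hi' : c i' u ≠ c i' v) (hix : c i x ≠ c i v)
    (hix' : c i' x ≠ c i' v) : i = i' :=
  hx.eq_of_ne h hk hd huv.symm (fun j hj => by rw [← hj]; exact (hx.2 j hj).symm) hi hi'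
    hix.symm hix'.symm

/-- The r − 1 common colors and `i` all separate, so `x`, `v` is again an extremal pair and
`SeparationBounds.eq_of_ne` applies to it. -/
theorem Far.le_card_sep {u v x : V} (hx : Far c part u v x)
    (hk : Fintype.card K + 1 = r + r) (hd : (sep c u v).card = r) {i : K}
    (hi : c i u ≠ c i v) (hix : c i x ≠ c i v) : r ≤ (sep c x v).card := by
  have hJ := card_common hk hd
  have hsub : insert i (sep c u v)ᶜ ⊆ sep c x v := by
    intro j hj
    simp only [Finset.mem_insert, Finset.mem_compl, mem_sep, not_not] at hj ⊢
    rcases hj with rfl | hj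
    · exact hix
    · rw [← hj]; exact hx.2 j hj
  have := Finset.card_le_card hsub
  rw [Finset.card_insert_of_notMem (by simp [hi])] at this
  omega

/-- If the far vertex `x` leaves the block of `v` in color `i`, then a vertex of a third class
leaves the block of `v` in at most one further color separating `u` and `v`. -/
theorem Far.third_eq_of_ne {u v x : V} (hx : Far c part u v x) (h : SeparationBounds part c r n)
    (hk : Fintype.card K + 1 = r + r) (huv : part u ≠ part v) (hd : (sep c u v).card = r) {i : K}
    (hi : c i u ≠ c i v) (hix : c i x ≠ c i v) {w : V} (hwu : part w ≠ part u)
    (hwv : part w ≠ part v) {i₁ i₂ : K} (h₁ : c i₁ u ≠ c i₁ v) (h₂ : c i₂ u ≠ c i₂ v)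
    (hi₁ : i₁ ≠ i) (hi₂ : i₂ ≠ i) (hw₁ : c i₁ w ≠ c i₁ v) (hw₂ : c i₂ w ≠ c i₂ v) : i₁ = i₂ := by
  have hxv : ∀ i', c i' u ≠ c i' v → i' ≠ i → c i' x = c i' v := fun i' hi' hne => by
    by_contra hcon
    exact hne (hx.unique_ne h hk huv hd hi' hi hcon hix)
  exact h.eq_of_ne (x := x) (v := v) (hx.1 ▸ huv) (hx.le_card_sep hk hd hi hix) (hx.1 ▸ hwu) hwv
    (hxv _ h₁ hi₁) (hxv _ h₂ hi₂) hw₁ hw₂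

end Transversal

/-! ### Case k = 2r − 1: incompatible far vertices -/

section Transversal

variable {V : Type u} {K L : Type*} {c : K → V → L} {r : ℕ} {part : V → Fin r} {a n : ℕ}

theorem Far.ne_right {u v x : V} (hx : Far c part u v x) (j : K) (hj : c j u = c j v) :
    c j x ≠ c j v := hj ▸ hx.2 j hj

variable [Fintype K]

theorem exists_three_sep (hr : 3 ≤ r) {u v : V} (hd : (sep c u v).card = r) :
    ∃ i₁ i₂ i₃, c i₁ u ≠ c i₁ v ∧ c i₂ u ≠ c i₂ v ∧ c i₃ u ≠ c i₃ v ∧ i₁ ≠ i₂ ∧ i₁ ≠ i₃ ∧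
      i₂ ≠ i₃ := by
  obtain ⟨i₁, i₂, i₃, h₁, h₂, h₃, h⟩ :=
    Finset.two_lt_card_iff.1 (show 2 < (sep c u v).card by omega)
  exact ⟨i₁, i₂, i₃, mem_sep.1 h₁, mem_sep.1 h₂, mem_sep.1 h₃, h⟩

theorem exists_ne_of_ne_of_ne (hr : 3 ≤ r) {u v : V} (hd : (sep c u v).card = r) (i₁ i₂ : K) :
    ∃ i, c i u ≠ c i v ∧ i ≠ i₁ ∧ i ≠ i₂ := by
  obtain ⟨a, b, d, ha, hb, hd, hab, had, hbd⟩ := exists_three_sep hr hd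
  by_cases h1 : a = i₁ ∨ a = i₂
  · by_cases h2 : b = i₁ ∨ b = i₂
    · exact ⟨d, hd, by grind, by grind⟩
    · exact ⟨b, hb, by grind, by grind⟩
  · exact ⟨a, ha, by grind, by grind⟩

variable [DecidableEq K]

theorem exists_common (hr : 3 ≤ r) (hk : Fintype.card K + 1 = r + r) {u v : V}
    (hd : (sep c u v).card = r) : ∃ j, c j u = c j v := by
  have := card_common hk hd
  obtain ⟨j, hj⟩ : (sep c u v)ᶜ.Nonempty := by rw [← Finset.card_pos]; omega
  exact ⟨j, by simpa using hj⟩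

/-- In a third class there is a vertex avoiding the block of `v` and those of two far vertices in
some common color of `u` and `v`; in the other common colors it lies in the block of `v`. -/
theorem exists_third_avoiding (h : SeparationBounds part c r n) (hn : 3 ≤ n)
    (hk : Fintype.card K + 1 = r + r) {u v : V} (huv : part u ≠ part v)
    (hd : (sep c u v).card = r) {x y : V} (hx : ∀ j, c j u = c j v → c j x ≠ c j v)
    (hy : ∀ j, c j u = c j v → c j y ≠ c j v) :
    ∃ w, part w ≠ part u ∧ part w ≠ part v ∧ (∃ j, c j u = c j v ∧ c j w ≠ c j v) ∧
      (∀ j, c j u = c j v → c j w ≠ c j x) ∧ ∀ j, c j u = c j v → c j w ≠ c j y := by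
  classical
  obtain ⟨j, hj⟩ := exists_common h.three_le hk hd
  obtain ⟨w, hwu, hwv, hw⟩ := h.exists_third u v j {v, x, y} (Finset.card_le_three.trans hn)
  have hwj : c j w ≠ c j v := hw v (by simp)
  have hJ : ∀ j', c j' u = c j' v → j' ≠ j → c j' w = c j' v := fun j' hj' hne => by
    by_contra hcon
    exact hne (h.eq_of_ne huv hd.ge hwu hwv hj' hj hcon hwj)
  refine ⟨w, hwu, hwv, ⟨j, hj, hwj⟩, fun j' hj' => ?_, fun j' hj' => ?_⟩
  · by_cases hjj : j' = j
    · subst hjj; exact hw x (by simp)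
    · rw [hJ j' hj' hjj]; exact (hx j' hj').symm
  · by_cases hjj : j' = j
    · subst hjj; exact hw y (by simp)
    · rw [hJ j' hj' hjj]; exact (hy j' hj').symm

/-- A suitable third-class w must leave v in i₁ and i₂, since otherwise it agrees with v in all
separating colors and leaves u in r + 1 colors. Then it agrees with v in i₃ and differs from x₃ in
all three. -/
theorem not_three_far_ne (h : SeparationBounds part c r n) (hn : 3 ≤ n)
    (hk : Fintype.card K + 1 = r + r) {u v : V} (huv : part u ≠ part v)
    (hd : (sep c u v).card = r) {x₁ x₂ x₃ : V} (hx₁ : Far c part u v x₁)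
    (hx₂ : Far c part u v x₂) (hx₃ : Far c part u v x₃) {i₁ i₂ i₃ : K} (h₁₂ : i₁ ≠ i₂)
    (h₁₃ : i₁ ≠ i₃) (h₂₃ : i₂ ≠ i₃) (h₁ : c i₁ u ≠ c i₁ v) (h₂ : c i₂ u ≠ c i₂ v)
    (h₃ : c i₃ u ≠ c i₃ v) (hi₁ : c i₁ x₁ ≠ c i₁ v) (hi₂ : c i₂ x₂ ≠ c i₂ v)
    (hi₃ : c i₃ x₃ ≠ c i₃ v) : False := by
  obtain ⟨w, hwu, hwv, ⟨j, hj, hwj⟩, hw₁, hw₂⟩ :=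
    exists_third_avoiding h hn hk huv hd hx₁.ne_right hx₂.ne_right
  have claim : ∀ x i, Far c part u v x → (∀ j, c j u = c j v → c j w ≠ c j x) →
      c i u ≠ c i v → c i x ≠ c i v → c i w ≠ c i v := by
    intro x i hx hwx hi hix hwi
    have hI : ∀ i', c i' u ≠ c i' v → c i' w = c i' v := by
      intro i' hi'
      by_cases hne : i' = i
      · exact hne ▸ hwi
      · have h1 : c i' w = c i' x := by
          by_contra hcon
          exact hne (hx.eq_of_ne h hk hd hwu hwx hi' hi hcon (by rw [hwi]; exact hix.symm))
        have h2 : c i' x = c i' v := by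
          by_contra hcon
          exact hne (hx.unique_ne h hk huv hd hi' hi hcon hix)
        rw [h1, h2]
    have hbig := h.card_le hwu (A := insert j (sep c u v)) fun i' hi' => by
      rcases Finset.mem_insert.1 hi' with rfl | hi'
      · rw [hj]; exact hwj
      · rw [hI i' (mem_sep.1 hi')]
        exact (mem_sep.1 hi').symm
    rw [Finset.card_insert_of_notMem (by simp [hj])] at hbig
    omega
  have hwi₁ := claim x₁ i₁ hx₁ hw₁ h₁ hi₁
  have hwi₂ := claim x₂ i₂ hx₂ hw₂ h₂ hi₂
  have hwi₃ : c i₃ w = c i₃ v := by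
    by_contra hcon
    exact h₂₃ (hx₁.third_eq_of_ne h hk huv hd h₁ hi₁ hwu hwv h₂ h₃ h₁₂.symm h₁₃.symm hwi₂ hcon)
  have hx₃v : ∀ i, c i u ≠ c i v → i ≠ i₃ → c i x₃ = c i v := fun i hi hne => by
    by_contra hcon
    exact hne (hx₃.unique_ne h hk huv hd hi h₃ hcon hi₃)
  exact hx₃.not_three_ne h hk huv hd hwu hwv h₁₂ h₁₃ h₂₃ h₁ h₂ h₃
    (by rw [hx₃v i₁ h₁ h₁₃]; exact hwi₁) (by rw [hx₃v i₂ h₂ h₂₃]; exact hwi₂)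
    (by rw [hwi₃]; exact hi₃.symm)

/-- Far vertices in the two classes differ in at most two of the colors separating `u`, `v`. -/
theorem Far.not_three_ne_far (h : SeparationBounds part c r n) (hn : 3 ≤ n)
    (hk : Fintype.card K + 1 = r + r) {u v : V} (huv : part u ≠ part v)
    (hd : (sep c u v).card = r) {x y : V} (hx : Far c part u v x)
    (hy : Far c part v u y) {i₁ i₂ i₃ : K} (h₁₂ : i₁ ≠ i₂)
    (h₁₃ : i₁ ≠ i₃) (h₂₃ : i₂ ≠ i₃) (h₁ : c i₁ u ≠ c i₁ v) (h₂ : c i₂ u ≠ c i₂ v)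
    (h₃ : c i₃ u ≠ c i₃ v) (hi₁ : c i₁ x ≠ c i₁ y) (hi₂ : c i₂ x ≠ c i₂ y)
    (hi₃ : c i₃ x ≠ c i₃ y) : False := by
  obtain ⟨w, hwu, hwv, -, hwx, hwy⟩ :=
    exists_third_avoiding h hn hk huv hd hx.ne_right (y := y) fun j hj => hy.2 j hj.symm
  have hX : ∀ i i', c i u ≠ c i v → c i' u ≠ c i' v → i ≠ i' → c i w ≠ c i x → c i' w = c i' x :=
    fun i i' hi hi' hne h1 => by
      by_contra h2
      exact hne (hx.eq_of_ne h hk hd hwu hwx hi hi' h1 h2)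
  have hY : ∀ i i', c i u ≠ c i v → c i' u ≠ c i' v → i ≠ i' → c i w ≠ c i y → c i' w = c i' y :=
    fun i i' hi hi' hne h1 => by
      by_contra h2
      exact hne (hy.eq_of_ne h hk (sep_comm (c := c) u v ▸ hd) hwv
        (fun j hj => hwy j hj.symm) hi.symm hi'.symm h1 h2)
  by_cases hx₁ : c i₁ w = c i₁ x
  · have hy₁ : c i₁ w ≠ c i₁ y := fun h' => hi₁ (hx₁.symm.trans h')
    have hx₂ : c i₂ w ≠ c i₂ x := fun h' => hi₂ (h'.symm.trans (hY _ _ h₁ h₂ h₁₂ hy₁))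
    exact hi₃ ((hX _ _ h₂ h₃ h₂₃ hx₂).symm.trans (hY _ _ h₁ h₃ h₁₃ hy₁))
  · have hy₂ : c i₂ w ≠ c i₂ y := fun h' => hi₂ ((hX _ _ h₁ h₂ h₁₂ hx₁).symm.trans h')
    exact hi₃ ((hX _ _ h₁ h₃ h₁₃ hx₁).symm.trans (hY _ _ h₂ h₃ h₂₃ hy₂))

/-- A third-class vertex leaving both blocks in color i would have to lie in both blocks in color
i'. -/
theorem not_far_ne_ne (h : SeparationBounds part c r n) (hn : 2 ≤ n)
    (hk : Fintype.card K + 1 = r + r) {u v : V} (huv : part u ≠ part v)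
    (hd : (sep c u v).card = r) {x y : V} (hx : Far c part u v x)
    (hy : Far c part v u y) {i₁ i₂ i i' : K} (h₁ : c i₁ u ≠ c i₁ v) (h₂ : c i₂ u ≠ c i₂ v)
    (hi : c i u ≠ c i v) (hi' : c i' u ≠ c i' v) (hx₁ : c i₁ x ≠ c i₁ v) (hy₂ : c i₂ y ≠ c i₂ u)
    (hii : i ≠ i') (hi₁ : i ≠ i₁) (hi₂ : i ≠ i₂) (hi₁' : i' ≠ i₁) (hi₂' : i' ≠ i₂) :
    False := by
  classical
  have hd' : (sep c v u).card = r := sep_comm (c := c) u v ▸ hd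
  obtain ⟨z, hzu, hzv, hz⟩ := h.exists_third u v i {u, v} (Finset.card_le_two.trans hn)
  have h3 : c i' z = c i' v := by
    by_contra hcon
    exact hii (hx.third_eq_of_ne h hk huv hd h₁ hx₁ hzu hzv hi hi' hi₁ hi₁' (hz v (by simp)) hcon)
  have h4 : c i' z = c i' u := by
    by_contra hcon
    exact hii (hy.third_eq_of_ne h hk huv.symm hd' h₂.symm hy₂ hzv hzu hi.symm hi'.symm hi₂ hi₂'
      (hz u (by simp)) hcon)
  exact hi' (h4.symm.trans h3)

/-- One may avoid the r − 1 common blocks and one block more. The vertex found is in the class of u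
or v, as a third-class vertex leaves at most one common block. -/
theorem exists_far_ne (h : SeparationBounds part c r n) (hk : Fintype.card K + 1 = r + r)
    {u v : V} (huv : part u ≠ part v) (hd : (sep c u v).card = r) (hc : Uncoverable c r)
    (i : K) (t : V) :
    (∃ x, Far c part u v x ∧ c i x ≠ c i t) ∨ ∃ y, Far c part v u y ∧ c i y ≠ c i t := by
  have hJ := card_common hk hd
  have hr := h.three_le
  obtain ⟨x, hxJ, hxt⟩ := hc.exists_ne (sep c u v)ᶜ {i} v t (by rw [Finset.card_singleton]; omega)
  replace hxJ : ∀ j, c j u = c j v → c j x ≠ c j v := fun j hj => hxJ j (by simpa using hj)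
  replace hxt : c i x ≠ c i t := hxt i (by simp)
  by_cases hxu : part x = part u
  · exact Or.inl ⟨x, ⟨hxu, fun j hj => by rw [hj]; exact hxJ j hj⟩, hxt⟩
  by_cases hxv : part x = part v
  · exact Or.inr ⟨x, ⟨hxv, fun j hj => hxJ j hj.symm⟩, hxt⟩
  obtain ⟨j, hj, j', hj', hne⟩ := Finset.one_lt_card.1 (show 1 < (sep c u v)ᶜ.card by omega)
  simp only [Finset.mem_compl, mem_sep, not_not] at hj hj'
  exact absurd (h.eq_of_ne huv hd.ge hxu hxv hj hj' (hxJ j hj) (hxJ j' hj')) hne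

theorem exists_far (h : SeparationBounds part c r n) (hn : 3 ≤ n)
    (hk : Fintype.card K + 1 = r + r) {u v : V} (huv : part u ≠ part v)
    (hd : (sep c u v).card = r) (hc : Uncoverable c r) : ∃ x, Far c part u v x := by
  by_contra! hcon
  have hd' : (sep c v u).card = r := sep_comm (c := c) u v ▸ hd
  obtain ⟨i₁, i₂, i₃, h₁, h₂, h₃, h₁₂, h₁₃, h₂₃⟩ := exists_three_sep h.three_le hd'
  have hN : ∀ i, ∃ y, Far c part v u y ∧ c i y ≠ c i u := fun i =>
    (exists_far_ne h hk huv hd hc i u).resolve_left fun ⟨x, hx, _⟩ => hcon x hx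
  obtain ⟨y₁, hy₁, hi₁⟩ := hN i₁
  obtain ⟨y₂, hy₂, hi₂⟩ := hN i₂
  obtain ⟨y₃, hy₃, hi₃⟩ := hN i₃
  exact not_three_far_ne h hn hk huv.symm hd' hy₁ hy₂ hy₃ h₁₂ h₁₃ h₂₃ h₁ h₂ h₃ hi₁ hi₂ hi₃

/-- Some far vertex in the class of `v` leaves the block of `u` in a color separating `u`, `v`. -/
theorem exists_far_ne_left (h : SeparationBounds part c r n) (hn : 3 ≤ n)
    (hk : Fintype.card K + 1 = r + r) {u v : V} (huv : part u ≠ part v)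
    (hd : (sep c u v).card = r) (hc : Uncoverable c r) :
    ∃ y i, Far c part v u y ∧ c i u ≠ c i v ∧ c i y ≠ c i u := by
  classical
  by_contra! hcon
  have hd' : (sep c v u).card = r := sep_comm (c := c) u v ▸ hd
  obtain ⟨y, hy⟩ := exists_far h hn hk huv.symm hd' hc
  have hyu : ∀ i, c i u ≠ c i v → c i y = c i u := fun i hi => hcon y i hy hi
  -- Otherwise `x` would agree with `v` in two further separating colors and so differ from `y` in
  -- three.
  have htyped : ∀ x, Far c part u v x → ∀ i, c i u ≠ c i v → c i x ≠ c i u →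
      ∃ i', c i' u ≠ c i' v ∧ c i' x ≠ c i' v ∧ i' ≠ i := by
    intro x hx i hi hxi
    by_contra! hall
    obtain ⟨i₂, h₂, h₂i, -⟩ := exists_ne_of_ne_of_ne h.three_le hd i i
    obtain ⟨i₃, h₃, h₃i, h₃₂⟩ := exists_ne_of_ne_of_ne h.three_le hd i i₂
    have hv : ∀ i', c i' u ≠ c i' v → i' ≠ i → c i' x ≠ c i' y := fun i' hi' hne => by
      have : c i' x = c i' v := by
        by_contra hcon'; exact hne (hall i' hi' hcon')
      rw [this, hyu i' hi']
      exact hi'.symm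
    exact hx.not_three_ne_far h hn hk huv hd hy h₂i.symm h₃i.symm h₃₂.symm hi h₂ h₃
      (by rw [hyu i hi]; exact hxi) (hv _ h₂ h₂i) (hv _ h₃ h₃i)
  have hN : ∀ i, c i u ≠ c i v → ∃ x, Far c part u v x ∧ c i x ≠ c i u := fun i hi =>
    (exists_far_ne h hk huv hd hc i u).resolve_right fun ⟨y', hy', hne⟩ => hne (hcon y' i hy' hi)
  obtain ⟨i₀, -, -, hi₀, -⟩ := exists_three_sep h.three_le hd
  obtain ⟨x₁, hx₁, hne₁⟩ := hN i₀ hi₀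
  obtain ⟨a, ha, hxa, -⟩ := htyped x₁ hx₁ i₀ hi₀ hne₁
  obtain ⟨x₂, hx₂, hne₂⟩ := hN a ha
  obtain ⟨b, hb, hxb, hba⟩ := htyped x₂ hx₂ a ha hne₂
  obtain ⟨d, hdI, hda, hdb⟩ := exists_ne_of_ne_of_ne h.three_le hd a b
  -- `x₁` and `x₂` force `z` into the block of `v` in colors `b` and `a`, so `z` differs from `y` in
  -- `a`, `b` and `d`.
  obtain ⟨z, hzu, hzv, hz⟩ := h.exists_third u v d {u, v} (Finset.card_le_two.trans (by omega))
  have hzb : c b z = c b v := by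
    by_contra hcon'
    exact hdb (hx₁.third_eq_of_ne h hk huv hd ha hxa hzu hzv hdI hb hda hba (hz v (by simp)) hcon')
  have hza : c a z = c a v := by
    by_contra hcon'
    exact hda (hx₂.third_eq_of_ne h hk huv hd hb hxb hzu hzv hdI ha hdb hba.symm
      (hz v (by simp)) hcon')
  exact hy.not_three_ne h hk huv.symm hd' hzv hzu hba hdb.symm hda.symm hb.symm ha.symm hdI.symm
    (by rw [hzb, hyu b hb]; exact hb.symm) (by rw [hza, hyu a ha]; exact ha.symm)
    (by rw [hyu d hdI]; exact hz u (by simp))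

/-- A third-class z leaving u and x in i₁ is forced by y and y' into the blocks of u in i₃ and i₂,
where x agrees with v; so z differs from x in three separating colors. -/
theorem not_far_three_ne (h : SeparationBounds part c r n) (hn : 3 ≤ n)
    (hk : Fintype.card K + 1 = r + r) {u v : V} (huv : part u ≠ part v)
    (hd : (sep c u v).card = r) {x y y' : V} (hx : Far c part u v x)
    (hy : Far c part v u y) (hy' : Far c part v u y') {i₁ i₂ i₃ : K}
    (h₁₂ : i₁ ≠ i₂) (h₁₃ : i₁ ≠ i₃) (h₂₃ : i₂ ≠ i₃)
    (h₁ : c i₁ u ≠ c i₁ v) (h₂ : c i₂ u ≠ c i₂ v) (h₃ : c i₃ u ≠ c i₃ v)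
    (hi₁ : c i₁ x ≠ c i₁ v) (hi₂ : c i₂ y ≠ c i₂ u) (hi₃ : c i₃ y' ≠ c i₃ u) : False := by
  classical
  have hd' : (sep c v u).card = r := sep_comm (c := c) u v ▸ hd
  obtain ⟨z, hzu, hzv, hz⟩ := h.exists_third u v i₁ {u, x} (Finset.card_le_two.trans (by omega))
  have hz₃ : c i₃ z = c i₃ u := by
    by_contra hcon
    exact h₁₃ (hy.third_eq_of_ne h hk huv.symm hd' h₂.symm hi₂ hzv hzu h₁.symm h₃.symm h₁₂
      h₂₃.symm (hz u (by simp)) hcon)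
  have hz₂ : c i₂ z = c i₂ u := by
    by_contra hcon
    exact h₁₂ (hy'.third_eq_of_ne h hk huv.symm hd' h₃.symm hi₃ hzv hzu h₁.symm h₂.symm h₁₃
      h₂₃ (hz u (by simp)) hcon)
  have hxv : ∀ i, c i u ≠ c i v → i ≠ i₁ → c i x = c i v := fun i hi hne => by
    by_contra hcon
    exact hne (hx.unique_ne h hk huv hd hi h₁ hcon hi₁)
  exact hx.not_three_ne h hk huv hd hzu hzv h₁₂ h₁₃ h₂₃ h₁ h₂ h₃ (hz x (by simp))
    (by rw [hz₂, hxv _ h₂ h₁₂.symm]; exact h₂) (by rw [hz₃, hxv _ h₃ h₁₃.symm]; exact h₃)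

theorem not_uncoverable_self (h : SeparationBounds part c r n) (hn : 3 ≤ n)
    (hk : Fintype.card K + 1 = r + r) {u v : V} (huv : part u ≠ part v)
    (hd : (sep c u v).card = r) : ¬ Uncoverable c r := by
  intro hc
  have hd' : (sep c v u).card = r := sep_comm (c := c) u v ▸ hd
  obtain ⟨y, b, hy, hb, hyb⟩ := exists_far_ne_left h hn hk huv hd hc
  obtain ⟨x, a, hx, ha, hxa⟩ := exists_far_ne_left h hn hk huv.symm hd' hc
  replace ha := ha.symm
  -- far vertices of the two classes never leave in the same color
  have hsame : ∀ i x y, Far c part u v x → Far c part v u y → c i u ≠ c i v → c i x ≠ c i v →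
      c i y ≠ c i u → False := by
    intro i x y hx hy hi hxi hyi
    obtain ⟨i₂, h₂, h₂i, -⟩ := exists_ne_of_ne_of_ne h.three_le hd i i
    obtain ⟨i₃, h₃, h₃i, h₃₂⟩ := exists_ne_of_ne_of_ne h.three_le hd i i₂
    exact not_far_ne_ne h (by omega) hk huv hd hx hy hi hi h₂ h₃ hxi hyi h₃₂.symm h₂i h₂i h₃i h₃i
  have hab : a ≠ b := by
    rintro rfl
    exact hsame a x y hx hy ha hxa hyb
  obtain ⟨d, hdI, hda, hdb⟩ := exists_ne_of_ne_of_ne h.three_le hd a b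
  have hYd : ∀ y', Far c part v u y' → c d y' = c d u := fun y' hy' => by
    by_contra hcon
    exact not_far_three_ne h hn hk huv hd hx hy hy' hab hda.symm hdb.symm ha hb hdI hxa hyb hcon
  have hXd : ∀ x', Far c part u v x' → c d x' = c d v := fun x' hx' => by
    by_contra hcon
    exact not_far_three_ne h hn hk huv.symm hd' hy hx hx' hab.symm hdb.symm hda.symm hb.symm
      ha.symm hdI.symm hyb hxa hcon
  have hYa : ∀ y', Far c part v u y' → c a y' = c a u := fun y' hy' => by
    by_contra hcon
    exact hsame a x y' hx hy' ha hxa hcon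
  have hXb : ∀ x', Far c part u v x' → c b x' = c b v := fun x' hx' => by
    by_contra hcon
    exact hsame b x' y hx' hy hb hcon hyb
  -- In color `a` only far vertices in the class of `u` can escape the block of `u`, and in color
  -- `b` only those in the class of `v` escape that of `v`. The two so found differ in `a`, `b` and
  -- `d`.
  obtain ⟨x', hx', hx'a⟩ := (exists_far_ne h hk huv hd hc a u).resolve_right
    fun ⟨y', hy', hne⟩ => hne (hYa y' hy')
  obtain ⟨y', hy', hne⟩ := (exists_far_ne h hk huv hd hc b v).resolve_left
    fun ⟨x', hx', hne⟩ => hne (hXb x' hx')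
  exact hx'.not_three_ne_far h hn hk huv hd hy' hab hda.symm hdb.symm ha hb hdI
    (by rw [hYa y' hy']; exact hx'a) (by rw [hXb x' hx']; exact hne.symm)
    (by rw [hXd x' hx', hYd y' hy']; exact hdI.symm)

theorem IsEdgeLabeling.not_uncoverable (h : IsEdgeLabeling part 1 c)
    (hs : Function.Surjective part) (hr : 3 ≤ r) (ha : 1 ≤ a) (har : a ≤ r)
    (hk : Fintype.card K + 1 = r + a) : ¬ Uncoverable c a := by
  intro hc
  have hb := h.separationBounds hs hr ha hk hc
  obtain ⟨u, v, huv, hd⟩ := exists_extremal_pair hs hb hk har hc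
  rcases har.lt_or_eq with hlt | rfl
  · rcases ha.lt_or_eq with ha2 | rfl
    · exact not_uncoverable_of_lt hb hk ha2 le_rfl hlt huv hd hc
    · exact not_separationBounds_one (by omega) le_rfl hd hb
  · exact not_uncoverable_self hb hr hk huv hd hc

end Transversal

/-! ### From colorings to labelings -/

section Components

variable {V : Type u} {E : Set (Finset V)} {k : ℕ}

theorem monoAdj_symm {col : EdgeColoring E k} {i : Fin k} {u v : V} (h : MonoAdj col i u v) :
    MonoAdj col i v u := by
  obtain ⟨e, he, hu, hv⟩ := h
  exact ⟨e, he, hv, hu⟩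

theorem monoComponent_eq_of_monoAdj {col : EdgeColoring E k} {i : Fin k} {u v : V}
    (h : MonoAdj col i u v) : monoComponent col i u = monoComponent col i v := by
  ext w
  exact ⟨fun hw => Relation.ReflTransGen.head (monoAdj_symm h) hw,
    fun hw => Relation.ReflTransGen.head h hw⟩

open Classical in
/-- The component of color `i` containing `v`, an unused color being replaced by `i₀`. -/
noncomputable def componentLabel (col : EdgeColoring E k) (i₀ i : Fin k) (v : V) : Set V :=
  monoComponent col (if ∃ e, col e = i then i else i₀) v

theorem coverNumber_le_of_not_uncoverable {col : EdgeColoring E k} {i₀ : Fin k} {q : ℕ}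
    (h : ¬ Uncoverable (componentLabel col i₀) q) : coverNumber col ≤ q := by
  classical
  simp only [Uncoverable, not_forall, not_exists] at h
  obtain ⟨F, hF, hcov⟩ := h
  push Not at hcov
  refine le_trans (Nat.sInf_le ?_) ((Finset.card_image_le
    (s := F) (f := fun p => componentLabel col i₀ p.1 p.2)).trans hF)
  refine ⟨_, rfl, fun C hC => ?_, fun x => ?_⟩
  · obtain ⟨p, -, rfl⟩ := Finset.mem_image.1 hC
    exact ⟨_, _, rfl⟩
  · obtain ⟨p, hp, hx⟩ := hcov x
    exact ⟨_, Finset.mem_image_of_mem _ hp, hx ▸ Relation.ReflTransGen.refl⟩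

end Components

/-! ### Upper bounds for the cover number -/

section Upper

variable {V : Type u} {r ℓ k : ℕ} {part : V → Fin r}

theorem nonempty_completeEdges (hl : 1 ≤ ℓ) (hs : Function.Surjective part) :
    (completeEdges part ℓ).Nonempty := by
  classical
  choose s hs using hs
  have hinj : Function.Injective s := fun p p' h => by rw [← hs p, h, hs p']
  refine ⟨Finset.univ.image s, ?_, fun i => le_trans (Finset.card_le_one.2 ?_) hl⟩
  · rw [Finset.card_image_of_injective _ hinj, Finset.card_univ, Fintype.card_fin]
  · simp only [Finset.mem_filter, Finset.mem_image, Finset.mem_univ, true_and]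
    rintro _ ⟨⟨p, rfl⟩, hp⟩ _ ⟨⟨p', rfl⟩, hp'⟩
    rw [hs] at hp hp'
    rw [hp, hp']

/-- Replacing unused colors by a used one ensures that every block contains an edge; otherwise their
components would be single vertices. -/
theorem isEdgeLabeling_componentLabel {col : EdgeColoring (completeEdges part ℓ) k}
    (hcol : IsSpanning col) (e₀ : completeEdges part ℓ) :
    IsEdgeLabeling part ℓ (componentLabel col (col e₀)) := by
  classical
  refine ⟨fun e he => ⟨col ⟨e, he⟩, fun u hu v hv => ?_⟩, fun i v => ?_⟩
  · have hused : ∃ e', col e' = col ⟨e, he⟩ := ⟨_, rfl⟩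
    simp only [componentLabel, hused, if_true]
    exact monoComponent_eq_of_monoAdj ⟨⟨e, he⟩, rfl, hu, hv⟩
  · have hused : ∃ e', col e' = if ∃ e, col e = i then i else col e₀ := by
      split_ifs with h
      exacts [h, ⟨e₀, rfl⟩]
    obtain ⟨e, he, hv⟩ := hcol _ hused v
    exact ⟨e, e.2, fun u hu => monoComponent_eq_of_monoAdj ⟨e, he, hu, hv⟩⟩

variable [Finite V] {col : EdgeColoring (completeEdges part ℓ) k}

theorem coverNumber_le (hr : 3 ≤ r) (hl : 1 ≤ ℓ) (hlr : ℓ ≤ r) (hk : 1 + r - ℓ ≤ k)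
    (hkl : ¬ (ℓ = 1 ∧ 2 * r ≤ k)) (hs : Function.Surjective part) (hcol : IsSpanning col) :
    coverNumber col ≤ 1 + (k + ℓ - r - 1) / ℓ := by
  classical
  obtain ⟨e₀, he₀⟩ := nonempty_completeEdges hl hs
  have h := isEdgeLabeling_componentLabel hcol ⟨e₀, he₀⟩
  refine coverNumber_le_of_not_uncoverable (i₀ := col ⟨e₀, he₀⟩) ?_
  rcases hl.eq_or_lt with rfl | hl2
  · rw [Nat.div_one]
    exact h.not_uncoverable hs hr (by omega) (by omega) (by rw [Fintype.card_fin]; omega)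
  have hq : Fintype.card (Fin k) + ℓ ≤ r + ℓ * (1 + (k + ℓ - r - 1) / ℓ) := by
    have := Nat.lt_mul_div_succ (k + ℓ - r - 1) (show 0 < ℓ by omega)
    rw [add_comm 1, Fintype.card_fin]
    omega
  rcases (show 2 ≤ ℓ from hl2).eq_or_lt with rfl | hl3
  · exact h.not_uncoverable_of_eq_two hs hr (by omega) hq
  · exact h.not_uncoverable_of_three_le hs hl3 hlr (Nat.le_add_right _ _) hq

theorem coverNumber_le_add_two {col : EdgeColoring (completeEdges part 1) k} (hr : 3 ≤ r)
    (hk : r ≤ k) (hs : Function.Surjective part) (hcol : IsSpanning col) :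
    coverNumber col ≤ 2 + (k - r) := by
  classical
  obtain ⟨e₀, he₀⟩ := nonempty_completeEdges le_rfl hs
  have h := isEdgeLabeling_componentLabel hcol ⟨e₀, he₀⟩
  refine coverNumber_le_of_not_uncoverable (i₀ := col ⟨e₀, he₀⟩) ?_
  rw [show 2 + (k - r) = (k - r + 1) + 1 by omega]
  exact h.not_uncoverable_add_one hs hr (by rw [Fintype.card_fin]; omega)

end Upper

/-! ### Extremal colorings for the lower bound -/

section Lower

/-- Vertices of the extremal hypergraphs: `avoid` lists the colors in which the vertex is outside
the main block; a vertex of the first class may avoid `m` colors, the others only one. -/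
structure BlockVertex (r k m : ℕ) : Type u where
  part : Fin r
  avoid : Finset (Fin k)
  copy : Fin (m + 1)
  tag : Fin k
  card_avoid_le : avoid.card ≤ m
  card_avoid_le_one : (part : ℕ) ≠ 0 → avoid.card ≤ 1

variable {r k m ℓ : ℕ}

instance : Finite (BlockVertex.{u} r k m) :=
  Finite.of_injective
    (fun v => (v.part, v.avoid, v.copy, v.tag) :
      BlockVertex.{u} r k m → Fin r × Finset (Fin k) × Fin (m + 1) × Fin k) <| by
    rintro ⟨⟩ ⟨⟩ h
    simpa using h

/-- The block of color `i` containing `v`: the main block or one of the copies. -/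
def blockLabel (i : Fin k) (v : BlockVertex.{u} r k m) : Option (Fin (m + 1)) :=
  if i ∈ v.avoid then some v.copy else none

theorem surjective_blockVertex_part (hk : 0 < k) :
    Function.Surjective (BlockVertex.part : BlockVertex.{u} r k m → Fin r) :=
  fun p => ⟨⟨p, ∅, 0, ⟨0, hk⟩, by simp, by simp⟩, rfl⟩

theorem exists_forall_notMem_avoid (hlr : ℓ ≤ r) (hk : r - ℓ + ℓ * m < k)
    {e : Finset (BlockVertex.{u} r k m)} (he : e ∈ completeEdges BlockVertex.part ℓ) :
    ∃ i, ∀ v ∈ e, i ∉ v.avoid := by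
  classical
  rcases Nat.eq_zero_or_pos r with rfl | hr
  · refine ⟨⟨0, by omega⟩, fun v hv => ?_⟩
    exact v.part.elim0
  suffices h : (e.biUnion BlockVertex.avoid).card < k by
    by_contra! hcon
    have huniv : e.biUnion BlockVertex.avoid = Finset.univ :=
      Finset.eq_univ_of_forall fun i => by simpa using hcon i
    rw [huniv, Finset.card_univ, Fintype.card_fin] at h
    exact h.false
  set p : Fin r := ⟨0, hr⟩
  have hle : ∀ v ∈ e, v.avoid.card ≤ if v.part = p then m else min 1 m := by
    intro v _
    -- The bound is `min 1 m` because no vertex avoids a color when `m` is 0.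
    split_ifs with hv
    · exact v.card_avoid_le
    · exact le_min (v.card_avoid_le_one fun h => hv (Fin.ext h)) v.card_avoid_le
  have hsum := Finset.card_biUnion_le.trans (Finset.sum_le_sum hle)
  rw [Finset.sum_ite, Finset.sum_const, Finset.sum_const, smul_eq_mul, smul_eq_mul] at hsum
  have hfil := Finset.card_filter_add_card_filter_not (s := e) (fun v => v.part = p)
  rw [he.1] at hfil
  have ha := he.2 p
  obtain ⟨d, hd⟩ := Nat.exists_eq_add_of_le ha
  refine hsum.trans_lt (lt_of_le_of_lt ?_ hk)
  rcases m with _ | m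
  · simp
  · rw [min_eq_left (by omega)]
    have : r - ℓ + d = (e.filter fun v => ¬ v.part = p).card := by omega
    rw [← this, hd]
    nlinarith [Nat.zero_le (d * m)]

/-- Every edge lies in one block of its color, and an edge all of whose vertices but one carry
the tag `i` has color `i` if it lies in one block of that color. -/
theorem exists_blockColoring (hr : 3 ≤ r) (hlr : ℓ ≤ r) (hk : r - ℓ + ℓ * m < k) :
    ∃ col : EdgeColoring (completeEdges (BlockVertex.part : BlockVertex.{u} r k m → Fin r) ℓ) k,
      (∀ e, ∀ u ∈ e.1, ∀ v ∈ e.1, blockLabel (col e) u = blockLabel (col e) v) ∧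
      ∀ e i, (∀ u ∈ e.1, ∀ v ∈ e.1, blockLabel i u = blockLabel i v) →
        (∃ v ∈ e.1, ∀ w ∈ e.1, w ≠ v → w.tag = i) → col e = i := by
  classical
  suffices h : ∀ e : completeEdges (BlockVertex.part : BlockVertex.{u} r k m → Fin r) ℓ,
      ∃ j : Fin k, (∀ u ∈ e.1, ∀ v ∈ e.1, blockLabel j u = blockLabel j v) ∧
        ∀ i, (∀ u ∈ e.1, ∀ v ∈ e.1, blockLabel i u = blockLabel i v) →
          (∃ v ∈ e.1, ∀ w ∈ e.1, w ≠ v → w.tag = i) → j = i by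
    choose col h₁ h₂ using h
    exact ⟨col, h₁, h₂⟩
  intro e
  by_cases hex : ∃ i : Fin k, (∀ u ∈ e.1, ∀ v ∈ e.1, blockLabel i u = blockLabel i v) ∧
      ∃ v ∈ e.1, ∀ w ∈ e.1, w ≠ v → w.tag = i
  · obtain ⟨j, hj, v, -, hvj⟩ := hex
    refine ⟨j, hj, fun i _ ⟨v', _, hvi⟩ => ?_⟩
    -- As r ≥ 3, two candidate colors share a vertex that is exceptional for neither, and its tag
    -- decides.
    obtain ⟨w, hw, hwv⟩ : ∃ w ∈ e.1, w ∉ ({v, v'} : Finset _) := by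
      by_contra! hcon
      have h1 := Finset.card_le_card hcon
      have h2 : ({v, v'} : Finset (BlockVertex.{u} r k m)).card ≤ 2 := Finset.card_le_two
      have h3 := e.2.1
      omega
    simp only [Finset.mem_insert, Finset.mem_singleton, not_or] at hwv
    rw [← hvj w hw hwv.1, hvi w hw hwv.2]
  · obtain ⟨j, hj⟩ := exists_forall_notMem_avoid hlr hk e.2
    refine ⟨j, fun u hu v hv => ?_, fun i hi hv => absurd ⟨i, hi, hv⟩ hex⟩
    simp [blockLabel, hj u hu, hj v hv]

theorem exists_isSpanning_lt_coverNumber (hr : 3 ≤ r) (hl : 1 ≤ ℓ) (hlr : ℓ ≤ r)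
    (hk : r - ℓ + ℓ * m < k) :
    ∃ col : EdgeColoring (completeEdges (BlockVertex.part : BlockVertex.{u} r k m → Fin r) ℓ) k,
      IsSpanning col ∧ m < coverNumber col := by
  classical
  obtain ⟨col, hcol, htag⟩ := exists_blockColoring.{u} hr hlr hk
  refine ⟨col, fun i _ v => ?_, ?_⟩
  -- The spanning edge: `v` and, in each other class, a vertex tagged `i` with the same block of
  -- color `i` as `v`.
  · let s : Fin r → BlockVertex.{u} r k m := fun p =>
      if p = v.part then v else
        ⟨p, v.avoid ∩ {i}, v.copy, i,
          (Finset.card_le_card Finset.inter_subset_left).trans v.card_avoid_le,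
          fun _ => (Finset.card_le_card Finset.inter_subset_right).trans (by simp)⟩
    have hpart : ∀ p, (s p).part = p := by
      intro p
      by_cases hp : p = v.part <;> simp [s, hp]
    have hlabel : ∀ p, blockLabel i (s p) = blockLabel i v := by
      intro p
      by_cases hp : p = v.part <;> simp [s, hp, blockLabel]
    have hinj : Function.Injective s := fun p p' h => by rw [← hpart p, h, hpart p']
    have he : Finset.univ.image s ∈
        completeEdges (BlockVertex.part : BlockVertex.{u} r k m → Fin r) ℓ := by
      refine ⟨?_, fun q => le_trans (Finset.card_le_one.2 ?_) hl⟩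
      · rw [Finset.card_image_of_injective _ hinj, Finset.card_univ, Fintype.card_fin]
      · simp only [Finset.mem_filter, Finset.mem_image, Finset.mem_univ, true_and]
        rintro _ ⟨⟨p, rfl⟩, hp⟩ _ ⟨⟨p', rfl⟩, hp'⟩
        rw [hpart] at hp hp'
        rw [hp, hp']
    have hv : v ∈ Finset.univ.image s :=
      Finset.mem_image.2 ⟨v.part, Finset.mem_univ _, by simp [s]⟩
    refine ⟨⟨_, he⟩, htag ⟨_, he⟩ i ?_ ⟨v, hv, ?_⟩, hv⟩
    · simp only [Finset.mem_image, Finset.mem_univ, true_and]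
      rintro _ ⟨p, rfl⟩ _ ⟨p', rfl⟩
      rw [hlabel, hlabel]
    · simp only [Finset.mem_image, Finset.mem_univ, true_and]
      rintro _ ⟨p, rfl⟩ hne
      by_cases hp : p = v.part
      · exact absurd (by simp [s, hp]) hne
      · simp [s, hp]
  · have hcomp : ∀ i v, ∀ w ∈ monoComponent col i v, blockLabel i w = blockLabel i v := by
      intro i v w hw
      induction hw with
      | refl => rfl
      | tail _ hadj ih =>
        obtain ⟨e, rfl, hu, hw⟩ := hadj
        rw [← ih, hcol e _ hu _ hw]
    have hk0 : 0 < k := by omega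
    refine le_csInf (exists_coverableBy col ⟨0, hk0⟩) ?_
    rintro n ⟨F, rfl, hF, hcov⟩
    by_contra! hlt
    have : Nonempty (Fin k) := ⟨⟨0, hk0⟩⟩
    have : Nonempty (BlockVertex.{u} r k m) :=
      ⟨⟨⟨0, by omega⟩, ∅, 0, ⟨0, hk0⟩, by simp, by simp⟩⟩
    choose! i v hiv using hF
    obtain ⟨y, hy⟩ : ∃ y, y ∉ F.image fun C => (v C).copy := by
      by_contra! hcon
      have h1 := (Finset.card_le_card (s := Finset.univ) fun y _ => hcon y).trans
        Finset.card_image_le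
      rw [Finset.card_univ, Fintype.card_fin] at h1
      omega
    -- `B` collects the colors of the chosen main blocks. The first-class vertex that avoids `B` and
    -- has the unused copy `y` lies in none of the chosen components.
    let B := (F.filter fun C => i C ∉ (v C).avoid).image i
    have hB : B.card ≤ m :=
      Finset.card_image_le.trans ((Finset.card_filter_le _ _).trans (by omega))
    obtain ⟨C, hC, hwC⟩ := hcov ⟨⟨0, by omega⟩, B, y, ⟨0, hk0⟩, hB, fun h => absurd rfl h⟩
    rw [hiv C hC] at hwC
    have hlab := hcomp _ _ _ hwC
    by_cases hi : i C ∈ (v C).avoid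
    · have hyC : y ≠ (v C).copy := fun h => hy (Finset.mem_image.2 ⟨C, hC, h.symm⟩)
      simp only [blockLabel, hi, if_true] at hlab
      split_ifs at hlab
      exact hyC (Option.some.inj hlab)
    · have hiB : i C ∈ B := Finset.mem_image_of_mem _ (Finset.mem_filter.2 ⟨hC, hi⟩)
      simp [blockLabel, hi, hiB] at hlab

end Lower

end PartiteCover

theorem mainTheorem1 (r ℓ k : ℕ) (hr : 3 ≤ r) (hl : 1 ≤ ℓ) (hlr : ℓ ≤ r) (hk : 1 + r - ℓ ≤ k) :
    (¬ (ℓ = 1 ∧ 2 * r ≤ k) →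
      PartiteCover.IsCov.{u} r ℓ k (1 + (k + ℓ - r - 1) / ℓ)) ∧
    (ℓ = 1 ∧ 2 * r ≤ k →
      ∃ m : ℕ, PartiteCover.IsCov.{u} r ℓ k m ∧
        1 + (k + ℓ - r - 1) / ℓ ≤ m ∧ m ≤ 2 + (k + ℓ - r - 1) / ℓ) := by
  have hkm : r - ℓ + ℓ * ((k + ℓ - r - 1) / ℓ) < k := by
    have := Nat.mul_div_le (k + ℓ - r - 1) ℓ
    omega
  obtain ⟨col, hcol, hlow⟩ :=
    PartiteCover.exists_isSpanning_lt_coverNumber.{u} hr hl hlr hkm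
  have hsurj := PartiteCover.surjective_blockVertex_part.{u} (r := r)
    (m := (k + ℓ - r - 1) / ℓ) (show 0 < k by omega)
  have hmem : PartiteCover.coverNumber col ∈ PartiteCover.coverNumbers.{u} r ℓ k :=
    ⟨_, inferInstance, _, hsurj, col, hcol, rfl⟩
  refine ⟨fun hkl => ?_, ?_⟩
  · have hup := PartiteCover.coverNumber_le hr hl hlr hk hkl hsurj hcol
    refine ⟨(hup.antisymm (Nat.one_add_le_iff.2 hlow)) ▸ hmem, ?_⟩
    rintro _ ⟨V, _, part, hs, col', hcol', rfl⟩
    exact PartiteCover.coverNumber_le hr hl hlr hk hkl hs hcol'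
  · rintro ⟨rfl, hkr⟩
    have hbdd : ∀ n ∈ PartiteCover.coverNumbers.{u} r 1 k, n ≤ 2 + (k - r) := by
      rintro _ ⟨V, _, part, hs, col', hcol', rfl⟩
      exact PartiteCover.coverNumber_le_add_two hr (by omega) hs hcol'
    have hmax := Nat.sSup_mem ⟨_, hmem⟩ ⟨_, hbdd⟩
    have hub : ∀ n ∈ PartiteCover.coverNumbers.{u} r 1 k, n ≤ sSup _ :=
      fun n hn => le_csSup ⟨_, hbdd⟩ hn
    refine ⟨_, ⟨hmax, hub⟩, ?_, ?_⟩
    · have := hub _ hmem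
      omega
    · have := hbdd _ hmax
      rw [Nat.div_one]
      omega
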